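/- All registers consist of qutrits with basis states $|k\rangle$, $k\in\mathbb Z_3$; $\omega=e^{2\pi i/3}$, $X|k\rangle=|k+1\rangle$, $Z|k\rangle=\omega^k|k\rangle$, $H|k\rangle=\tfrac1{\sqrt3}\sum_j\omega^{jk}|j\rangle$, $CX_{2\to1}|a,b\rangle=|a+b,b\rangle$, and $T=\mathrm{diag}(1,e^{2\pi i/9},e^{-2\pi i/9})$. A qutrit stabilizer code $\llbracket n,k,d\rrbracket$ is a $3^k$-dimensional space of $n$-qutrit states that is the joint $+1$ eigenspace of a set of Pauli operators, where $d$ is the least weight of a Pauli operator that preserves the space without acting on it as a scalar. A physical operator $P$ implements a logical operator $L$ through an encoder (an isometry onto the code) $E$ if $PE=EL$. **Outer code.** Let $C_{\rm out}$ be the code with stabilizer generators $X_1X_2X_3X_4X_5X_6$, $Z_1Z_2Z_3$, $Z_2Z_3^2Z_4^2Z_5$, $Z_4Z_5Z_6$, and let $E_{\rm out}=E_{pf}\,(X\otimes H^\dagger)\,CX_{2\to1}^\dagger$, where $E_{pf}|a,b\rangle=\tfrac1{\sqrt3}\sum_{s\in\mathbb Z_3}|a\,(2,1,0,2,1,0)+b\,(1,1,1,0,0,0)+s\,(1,1,1,1,1,1)\rangle$.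 **Inner code.** Let $C_{\rm in}$ be the CSS code on 8 qutrits labelled by the points $p=(p_1,p_2)\in\mathbb Z_3^2\setminus\{0\}$, with X-type stabilizers generated by $\prod_pX_p^{p_1}$ and $\prod_pX_p^{p_2}$, and Z-type stabilizers $\prod_pZ_p^{v_p}$ for all $v$ with $\sum_pv_p=\sum_pv_pp_1=\sum_pv_pp_2=0$; let $E_{\rm in}|k\rangle=\tfrac13\sum_{\alpha,\beta\in\mathbb Z_3}\bigotimes_p|\alpha p_1+\beta p_2-k\rangle$. **Logical gate.** Let $\mathrm{AND}$ be the two-qutrit permutation unitary with $|a,a+1\rangle\mapsto|a-1,a\rangle$ for $a\in\mathbb Z_3$, fixing all other basis states. It emulates the binary AND gate: for $a,b\in\{0,1\}$ it maps $|a,b\rangle$ to $|c,a\wedge b\rangle$ for some $c\in\mathbb Z_3$. **Theorem.** 1. $C_{\rm out}$ is a $\llbracket 6,2,2\rrbracket$ code with encoder $E_{\rm out}$, through which $X_1^2X_2X_4^2X_5$, $\omega^2X_1X_2X_3Z_4Z_5^2$, $X_1X_2^2Z_3^2X_4X_5^2Z_6$, $X_1X_2X_3$ implement the logical $X_1,Z_1,X_2,Z_2$,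 and $T^{\otimes3}\otimes(T^\dagger)^{\otimes3}$ implements $\mathrm{AND}$. 2. $C_{\rm in}$ is an $\llbracket 8,1,2\rrbracket$ code with encoder $E_{\rm in}$, through which $(X^\dagger)^{\otimes8}$, $Z^{\otimes8}$ and $T^{\otimes8}$ implement the logical $X$, $Z$ and $T$. 3. The concatenated code $C=E_{\rm in}^{\otimes6}(C_{\rm out})$ is a $\llbracket 48,2,4\rrbracket$ qutrit code, and its distance is the product of the distances of $C_{\rm out}$ and $C_{\rm in}$. $E_{\rm in}^{\otimes6}E_{\rm out}$ is an encoder of $C$, through which the transversal gate with $T$ on the 24 qutrits of the first three blocks and $T^\dagger$ on the 24 qutrits of the other three blocks implements $\mathrm{AND}$. -/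

import Mathlib

open Matrix

noncomputable section

namespace QutritCode

/-! ### Qutrit registers, Pauli operators and stabilizer codes

The computational basis of a register of qutrits indexed by `ι` is `ι → ZMod 3`; states are
functions from it to `ℂ` and operators are complex matrices. -/

/-- The power `ω ^ k` of the primitive cube root of unity `ω = exp (2πi/3)`. -/
def chi (k : ZMod 3) : ℂ := Complex.exp (2 * Real.pi * Complex.I / 3) ^ k.val

section Register

variable {ι : Type} [Fintype ι] [DecidableEq ι]

/-- `X^u`, acting as `|y⟩ ↦ |y + u⟩`. -/
def xOp (u : ι → ZMod 3) : Matrix (ι → ZMod 3) (ι → ZMod 3) ℂ :=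
  Matrix.of fun x y => if x = y + u then 1 else 0

/-- `Z^v`, acting as `|y⟩ ↦ ω^(v · y) |y⟩`. -/
def zOp (v : ι → ZMod 3) : Matrix (ι → ZMod 3) (ι → ZMod 3) ℂ :=
  Matrix.diagonal fun y => chi (v ⬝ᵥ y)

/-- The general element `ω^c X^u Z^v` of the qutrit Pauli group. -/
def pauli (c : ZMod 3) (u v : ι → ZMod 3) : Matrix (ι → ZMod 3) (ι → ZMod 3) ℂ :=
  chi c • (xOp u * zOp v)

/-- The number of qutrits on which `X^u Z^v` acts non-trivially. -/
def pauliWeight (u v : ι → ZMod 3) : ℕ :=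
  (Finset.univ.filter fun i => u i ≠ 0 ∨ v i ≠ 0).card

/-- The states fixed by every Pauli operator `ω^c X^u Z^v` with `(c, u, v)` in `G`. -/
def fixedSpace (G : Set (ZMod 3 × (ι → ZMod 3) × (ι → ZMod 3))) :
    Submodule ℂ ((ι → ZMod 3) → ℂ) where
  carrier := {ψ | ∀ g ∈ G, pauli g.1 g.2.1 g.2.2 *ᵥ ψ = ψ}
  zero_mem' := fun g _ => Matrix.mulVec_zero _
  add_mem' := fun ha hb g hg => by rw [Matrix.mulVec_add, ha g hg, hb g hg]
  smul_mem' := fun c ψ hψ g hg => by rw [Matrix.mulVec_smul, hψ g hg]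

/-- The CSS code with X-type stabilizer generators `X^u`, `u ∈ SX`, and Z-type stabilizer
generators `Z^v`, `v ∈ SZ`. -/
def cssCode (SX SZ : Set (ι → ZMod 3)) : Submodule ℂ ((ι → ZMod 3) → ℂ) :=
  fixedSpace ({g | g.1 = 0 ∧ g.2.1 ∈ SX ∧ g.2.2 = 0} ∪ {g | g.1 = 0 ∧ g.2.1 = 0 ∧ g.2.2 ∈ SZ})

/-- `X^u Z^v` is a non-trivial logical operator of the code `C`: it preserves `C` and does not
act on `C` as a scalar. -/
def IsNontrivialLogical (C : Submodule ℂ ((ι → ZMod 3) → ℂ)) (u v : ι → ZMod 3) : Prop :=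
  (∀ ψ ∈ C, pauli 0 u v *ᵥ ψ ∈ C) ∧ ¬ ∃ z : ℂ, ∀ ψ ∈ C, pauli 0 u v *ᵥ ψ = z • ψ

/-- The weights of the non-trivial logical Pauli operators of `C`. -/
def logicalWeights (C : Submodule ℂ ((ι → ZMod 3) → ℂ)) : Set ℕ :=
  {w | ∃ u v, IsNontrivialLogical C u v ∧ pauliWeight u v = w}

/-- The distance of a code: the least weight of a non-trivial logical Pauli operator. -/
def codeDistance (C : Submodule ℂ ((ι → ZMod 3) → ℂ)) : ℕ := sInf (logicalWeights C)

/-- `C` is an `⟦n, k, d⟧` qutrit stabilizer code. -/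
structure IsQutritCode (n k d : ℕ) (C : Submodule ℂ ((ι → ZMod 3) → ℂ)) : Prop where
  stabilizer : ∃ G, C = fixedSpace G
  length : Fintype.card ι = n
  dimension : Module.finrank ℂ C = 3 ^ k
  distance : IsLeast (logicalWeights C) d

/-- The transversal operator `⨂ i, U i`. -/
def tensorGate (U : ι → Matrix (ZMod 3) (ZMod 3) ℂ) : Matrix (ι → ZMod 3) (ι → ZMod 3) ℂ :=
  Matrix.of fun x y => ∏ i, U i (x i) (y i)

/-- `E` is an encoder (an isometry) of logical states with basis `A` onto the code `C`. -/
def IsEncoder {A : Type} [Fintype A] [DecidableEq A] (E : Matrix (ι → ZMod 3) A ℂ)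
    (C : Submodule ℂ ((ι → ZMod 3) → ℂ)) : Prop :=
  Eᴴ * E = 1 ∧ LinearMap.range E.mulVecLin = C

/-- The physical operator `P` implements the logical operator `L` through the encoder `E`. -/
def Implements {A : Type} [Fintype A] (E : Matrix (ι → ZMod 3) A ℂ)
    (P : Matrix (ι → ZMod 3) (ι → ZMod 3) ℂ) (L : Matrix A A ℂ) : Prop :=
  P * E = E * L

open Classical in
/-- The CSS encoder `|a⟩ ↦ |S|^(-1/2) ∑_{s ∈ S} |ℓ a + s⟩`, where `S` is the space of X-type
stabilizers and `X^(ℓ a)` is the logical shift by `a`. -/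
def cssEncoder {A : Type} (S : Submodule (ZMod 3) (ι → ZMod 3)) (ℓ : A → ι → ZMod 3) :
    Matrix (ι → ZMod 3) A ℂ :=
  Matrix.of fun x a => if x - ℓ a ∈ S then ((Real.sqrt (Nat.card S))⁻¹ : ℂ) else 0

/-- `V ⊗ ⋯ ⊗ V`, encoding every qutrit of the register `ι` into its own block `κ`. -/
def blockEncoder {κ : Type} [Fintype κ] (V : Matrix (κ → ZMod 3) (ZMod 3) ℂ) :
    Matrix (ι × κ → ZMod 3) (ι → ZMod 3) ℂ :=
  Matrix.of fun x y => ∏ i, V (fun j => x (i, j)) (y i)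

/-- The concatenation of the outer code `C` with the inner code encoded by `V`. -/
def concatenate {κ : Type} [Fintype κ] (C : Submodule ℂ ((ι → ZMod 3) → ℂ))
    (V : Matrix (κ → ZMod 3) (ZMod 3) ℂ) : Submodule ℂ ((ι × κ → ZMod 3) → ℂ) :=
  C.map (blockEncoder V).mulVecLin

end Register

/-! ### Gates -/

/-- The qutrit `X` gate, `|k⟩ ↦ |k + 1⟩`. -/
def xGate : Matrix (ZMod 3) (ZMod 3) ℂ := Matrix.of fun x y => if x = y + 1 then 1 else 0

/-- The qutrit `Z` gate, `|k⟩ ↦ ω^k |k⟩`. -/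
def zGate : Matrix (ZMod 3) (ZMod 3) ℂ := Matrix.diagonal chi

/-- The qutrit Hadamard gate, `|k⟩ ↦ 3^(-1/2) ∑_j ω^(jk) |j⟩`. -/
def hGate : Matrix (ZMod 3) (ZMod 3) ℂ := Matrix.of fun j k => ((Real.sqrt 3)⁻¹ : ℂ) * chi (j * k)

/-- The qutrit `T` gate `diag(1, e^(2πi/9), e^(-2πi/9))`. -/
def tGate : Matrix (ZMod 3) (ZMod 3) ℂ :=
  Matrix.diagonal fun k =>
    if k = 0 then 1
    else if k = 1 then Complex.exp (2 * Real.pi * Complex.I / 9)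
    else Complex.exp (-(2 * Real.pi * Complex.I / 9))

/-- The transversal gate with `T` on the qutrits in `A` and `T†` on all the others. -/
def tLayer {ι : Type} [Fintype ι] [DecidableEq ι] (A : Finset ι) :
    Matrix (ι → ZMod 3) (ι → ZMod 3) ℂ :=
  tensorGate fun i => if i ∈ A then tGate else tGateᴴ

/-- The `CX` gate controlled on the second qutrit, `|a, b⟩ ↦ |a + b, b⟩`. -/
def cxGate : Matrix (Fin 2 → ZMod 3) (Fin 2 → ZMod 3) ℂ :=
  Matrix.of fun x y => if x = ![y 0 + y 1, y 1] then 1 else 0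

/-- The ternary reversible AND: `|a, a + 1⟩ ↦ |a - 1, a⟩`, all other basis states are fixed.
Its truth table is
`00 ↦ 00, 01 ↦ 20, 02 ↦ 02, 10 ↦ 10, 11 ↦ 11, 12 ↦ 01, 20 ↦ 12, 21 ↦ 21, 22 ↦ 22`. -/
def andGate : Matrix (Fin 2 → ZMod 3) (Fin 2 → ZMod 3) ℂ :=
  Matrix.of fun x y =>
    if x = (if y 1 = y 0 + 1 then ![y 0 - 1, y 1 - 1] else y) then 1 else 0

/-- The two-qutrit operator `U` emulates the binary AND gate: on binary inputs `a, b` the second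
output qutrit is `a ∧ b`; the first output, and the other inputs, are unconstrained. -/
def EmulatesAnd (U : Matrix (Fin 2 → ZMod 3) (Fin 2 → ZMod 3) ℂ) : Prop :=
  ∀ a b : Bool, ∃ c : ZMod 3,
    U *ᵥ Pi.single ![(a.toNat : ZMod 3), (b.toNat : ZMod 3)] 1 =
      Pi.single ![c, ((a && b).toNat : ZMod 3)] 1

/-! ### The outer code -/

/-- The outer code, with X-type stabilizer `X₁X₂X₃X₄X₅X₆` and Z-type stabilizers `Z₁Z₂Z₃`,
`Z₂Z₃²Z₄²Z₅`, `Z₄Z₅Z₆`. -/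
def outerCode : Submodule ℂ ((Fin 6 → ZMod 3) → ℂ) :=
  cssCode {![1, 1, 1, 1, 1, 1]}
    {![1, 1, 1, 0, 0, 0], ![0, 1, 2, 2, 1, 0], ![0, 0, 0, 1, 1, 1]}

/-- The CSS encoder of the outer code whose logical X operators are `X₁²X₂X₄²X₅` and
`X₁X₂X₃`. -/
def outerCssEncoder : Matrix (Fin 6 → ZMod 3) (Fin 2 → ZMod 3) ℂ :=
  cssEncoder (Submodule.span (ZMod 3) {![1, 1, 1, 1, 1, 1]})
    fun a => a 0 • ![2, 1, 0, 2, 1, 0] + a 1 • ![1, 1, 1, 0, 0, 0]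

/-- The full encoder of the outer code: a logical two-qutrit Clifford gate (`CX†`, then `H†` on
the second and `X` on the first qutrit) followed by the CSS encoder. -/
def outerEncoder : Matrix (Fin 6 → ZMod 3) (Fin 2 → ZMod 3) ℂ :=
  outerCssEncoder * tensorGate ![xGate, hGateᴴ] * cxGateᴴ

/-! ### The inner code: the punctured first-order quantum Reed–Muller code -/

/-- The eight non-zero points of the plane over `ZMod 3`, labelling the qutrits of the inner
code. -/
abbrev Pt : Type := {p : ZMod 3 × ZMod 3 // p ≠ 0}

/-- The generators of the X-type stabilizers of the inner code: the two coordinate functions. -/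
def innerX : Set (Pt → ZMod 3) := {fun p => p.1.1, fun p => p.1.2}

/-- The Z-type stabilizers of the inner code: the dual of the space of affine functions. -/
def innerZ : Set (Pt → ZMod 3) :=
  {v | ∑ p, v p = 0 ∧ ∑ p, v p * p.1.1 = 0 ∧ ∑ p, v p * p.1.2 = 0}

/-- The inner code. -/
def innerCode : Submodule ℂ ((Pt → ZMod 3) → ℂ) := cssCode innerX innerZ

/-- The encoder of the inner code with logical X operator `X† ⊗ ⋯ ⊗ X†`. -/
def innerEncoder : Matrix (Pt → ZMod 3) (ZMod 3) ℂ :=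
  cssEncoder (Submodule.span (ZMod 3) innerX) fun k _ => -k

/-! ### The concatenated code -/

/-- The concatenation of the outer with the inner code, on `6 · 8` qutrits. -/
def concatCode : Submodule ℂ ((Fin 6 × Pt → ZMod 3) → ℂ) := concatenate outerCode innerEncoder

/-- The encoder of the concatenated code. -/
def concatEncoder : Matrix (Fin 6 × Pt → ZMod 3) (Fin 2 → ZMod 3) ℂ :=
  blockEncoder innerEncoder * outerEncoder

/-- The qutrits of the first three blocks. -/
def firstBlocks : Finset (Fin 6 × Pt) := Finset.univ.filter fun q => q.1 < 3

end QutritCode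

end

open QutritCode

open QutritCode

noncomputable section

set_option linter.unusedSectionVars false

namespace QutritCode

/-! ### The character `chi` -/

/-! A CSS code is described by two linear codes `S ≤ N` over `ZMod 3`: its states are the functions
supported on `N` and constant on the cosets of `S` (`cssCode_eq_cssSpace`). Normalised indicators of
the cosets in `N / S` form an encoder (`isEncoder_cssEncoder`), which gives the dimension.
Non-trivial logical Paulis need `u ∈ N \ S` or `v ∈ S^⊥ \ N^⊥`, so the distance bounds are
statements about weights of ternary vectors (`isLeast_logicalWeights`).

The gate `T` has phases `ζ ^ (k ^ 3)` with `ζ = exp (2πi/9)`, so a layer of `T` and `T†` is a cubic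
sum in `ZMod 9`. The cubes of the three elements of `ZMod 3` sum to 0 modulo 9. For the inner code
this makes the sum of the cubes of an affine function over the whole plane vanish; deleting the
origin leaves one logical `T`. For the outer code the layer becomes the phase `ω ^ a 1` on `a 0 =
0`, which the Clifford part of the encoder conjugates into `andGate`.

Encoding each qutrit of a CSS code by the inner code gives a CSS code again
(`concatenate_innerEncoder`). A non-trivial logical operator of the concatenated code must touch two
blocks, with weight at least two in each, whence distance 4; the logical gate is the composite of
the two transversal implementations. -/

lemma chi_eq_stdAddChar (k : ZMod 3) : chi k = ZMod.stdAddChar k := by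
  rw [chi, ← Complex.exp_nat_mul, ZMod.stdAddChar_apply, ZMod.toCircle_apply]
  congr 1
  push_cast
  ring

lemma chi_add (a b : ZMod 3) : chi (a + b) = chi a * chi b := by
  simp only [chi_eq_stdAddChar, AddChar.map_add_eq_mul]

lemma chi_zero : chi 0 = 1 := by simp [chi_eq_stdAddChar]

lemma chi_eq_one_iff (a : ZMod 3) : chi a = 1 ↔ a = 0 := by
  rw [chi_eq_stdAddChar, ← AddChar.map_zero_eq_one (ZMod.stdAddChar (N := 3))]
  exact ZMod.injective_stdAddChar.eq_iff

lemma star_chi (a : ZMod 3) : star (chi a) = chi (-a) := by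
  rw [chi_eq_stdAddChar, chi_eq_stdAddChar, AddChar.map_neg_eq_conj]
  rfl

section Register

variable {ι : Type} [Fintype ι] [DecidableEq ι]

/-! ### Action of Pauli operators -/

lemma pauli_mul_apply {A : Type} (c : ZMod 3) (u v : ι → ZMod 3)
    (M : Matrix (ι → ZMod 3) A ℂ) (x : ι → ZMod 3) (a : A) :
    (pauli c u v * M) x a = chi (c + v ⬝ᵥ (x - u)) * M (x - u) a := by
  have h : ∀ y, x = y + u ↔ y = x - u := fun y => by rw [eq_comm, eq_sub_iff_add_eq]
  rw [pauli, Matrix.smul_mul, Matrix.mul_assoc, Matrix.smul_apply, Matrix.mul_apply]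
  simp only [xOp, zOp, Matrix.of_apply, Matrix.diagonal_mul, ite_mul, one_mul, zero_mul, h]
  rw [Finset.sum_ite_eq' Finset.univ (x - u)]
  simp [chi_add, mul_assoc]

lemma pauli_mulVec_apply (c : ZMod 3) (u v : ι → ZMod 3) (ψ : (ι → ZMod 3) → ℂ)
    (x : ι → ZMod 3) :
    (pauli c u v *ᵥ ψ) x = chi (c + v ⬝ᵥ (x - u)) * ψ (x - u) :=
  pauli_mul_apply c u v (Matrix.of fun x (_ : Unit) => ψ x) x ()

lemma mul_xOp_apply {A : Type} (M : Matrix A (ι → ZMod 3) ℂ) (u : ι → ZMod 3) (a : A)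
    (y : ι → ZMod 3) : (M * xOp u) a y = M a (y + u) := by
  simp [Matrix.mul_apply, xOp]

lemma mul_zOp_apply {A : Type} (M : Matrix A (ι → ZMod 3) ℂ) (v : ι → ZMod 3) (a : A)
    (y : ι → ZMod 3) : (M * zOp v) a y = M a y * chi (v ⬝ᵥ y) := by
  simp [zOp]

/-! ### Spaces of states described by a pair of linear codes -/

/-- The states supported on `N` and invariant under translations by `S`. -/
def cssSpace (S N : Submodule (ZMod 3) (ι → ZMod 3)) : Submodule ℂ ((ι → ZMod 3) → ℂ) where
  carrier := {ψ | (∀ x, ψ x ≠ 0 → x ∈ N) ∧ ∀ s ∈ S, ∀ x, ψ (x + s) = ψ x}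
  zero_mem' := ⟨fun _ h => absurd rfl h, fun _ _ _ => rfl⟩
  add_mem' := by
    rintro φ ψ ⟨hφ, hφ'⟩ ⟨hψ, hψ'⟩
    refine ⟨fun x hx => ?_, fun s hs x => ?_⟩
    · by_cases h : φ x = 0
      · exact hψ x fun h' => hx (by simp [h, h'])
      · exact hφ x h
    · simp [hφ' s hs, hψ' s hs]
  smul_mem' := by
    rintro c ψ ⟨hψ, hψ'⟩
    exact ⟨fun x hx => hψ x fun h => hx (by simp [h]), fun s hs x => by simp [hψ' s hs]⟩

/-- The vectors orthogonal to `V` for the dot product. -/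
def dotPerp (V : Set (ι → ZMod 3)) : Submodule (ZMod 3) (ι → ZMod 3) where
  carrier := {y | ∀ v ∈ V, v ⬝ᵥ y = 0}
  zero_mem' := fun _ _ => dotProduct_zero _
  add_mem' := fun ha hb v hv => by rw [dotProduct_add, ha v hv, hb v hv, add_zero]
  smul_mem' := fun c y hy v hv => by rw [dotProduct_smul, hy v hv, smul_zero]

lemma mem_dotPerp {V : Set (ι → ZMod 3)} {y : ι → ZMod 3} :
    y ∈ dotPerp V ↔ ∀ v ∈ V, v ⬝ᵥ y = 0 := Iff.rfl

/-- Double annihilators over a field, carried to the dot product by `dotProductEquiv`. This is what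
turns any pair `S`, `N` into a code with Pauli stabilizers. -/
lemma dotPerp_dotPerp (N : Submodule (ZMod 3) (ι → ZMod 3)) :
    dotPerp (dotPerp (N : Set (ι → ZMod 3)) : Set (ι → ZMod 3)) = N := by
  ext y
  rw [← Subspace.forall_mem_dualAnnihilator_apply_eq_zero_iff N y, mem_dotPerp]
  constructor
  · intro h φ hφ
    obtain ⟨v, rfl⟩ := (dotProductEquiv (ZMod 3) ι).surjective φ
    refine h v fun w hw => ?_
    rw [dotProduct_comm]
    exact (Submodule.mem_dualAnnihilator _).1 hφ w hw
  · intro h v hv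
    refine h (dotProductEquiv (ZMod 3) ι v) ((Submodule.mem_dualAnnihilator _).2 fun w hw => ?_)
    exact (dotProduct_comm _ _).trans (hv w hw)

/-- `Z^v` fixes a state exactly when its support is orthogonal to `v`, and `X^u` exactly when the
state is invariant under translation by `u`; invariance passes to the span. -/
lemma cssCode_eq_cssSpace (SX SZ : Set (ι → ZMod 3)) :
    cssCode SX SZ = cssSpace (Submodule.span (ZMod 3) SX) (dotPerp SZ) := by
  ext ψ
  constructor
  · intro h
    have hX : ∀ u ∈ SX, pauli 0 u 0 *ᵥ ψ = ψ := fun u hu => h (0, u, 0) (Or.inl ⟨rfl, hu, rfl⟩)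
    have hZ : ∀ v ∈ SZ, pauli 0 0 v *ᵥ ψ = ψ := fun v hv => h (0, 0, v) (Or.inr ⟨rfl, rfl, hv⟩)
    refine ⟨fun x hx v hv => ?_, fun s hs => ?_⟩
    · have := congrFun (hZ v hv) x
      rw [pauli_mulVec_apply, sub_zero, zero_add] at this
      exact (chi_eq_one_iff _).1 (mul_right_cancel₀ hx (this.trans (one_mul _).symm))
    · induction hs using Submodule.span_induction with
      | mem u hu =>
        intro x
        have := congrFun (hX u hu) (x + u)
        rw [pauli_mulVec_apply, zero_dotProduct, zero_add, chi_zero, one_mul,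
          add_sub_cancel_right] at this
        exact this.symm
      | zero => simp
      | add a b _ _ ha hb => intro x; rw [← add_assoc, hb, ha]
      | smul c a _ ha =>
        -- Scalars in `ZMod 3` are residues of natural numbers, so scaling is repeated addition.
        have key : ∀ n : ℕ, ∀ x, ψ (x + n • a) = ψ x := by
          intro n
          induction n with
          | zero => simp
          | succ n ih => intro x; rw [succ_nsmul, ← add_assoc, ha, ih]
        intro x
        have h := key c.val x
        rwa [← Nat.cast_smul_eq_nsmul (ZMod 3), ZMod.natCast_zmod_val] at h
  · rintro ⟨hN, hS⟩
    rintro ⟨c, u, v⟩ (⟨rfl, hu, rfl⟩ | ⟨rfl, rfl, hv⟩)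
    · ext x
      have := hS u (Submodule.subset_span hu) (x - u)
      simp only [pauli_mulVec_apply, zero_dotProduct, zero_add, chi_zero, one_mul]
      rw [← this, sub_add_cancel]
    · ext x
      simp only [pauli_mulVec_apply, sub_zero, zero_add]
      by_cases hx : ψ x = 0
      · rw [hx, mul_zero]
      · rw [hN x hx v hv, chi_zero, one_mul]

lemma cssSpace_eq_cssCode (S N : Submodule (ZMod 3) (ι → ZMod 3)) :
    cssSpace S N = cssCode (S : Set (ι → ZMod 3)) (dotPerp (N : Set (ι → ZMod 3))) := by
  rw [cssCode_eq_cssSpace, Submodule.span_eq, dotPerp_dotPerp]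

lemma exists_cssSpace_eq_fixedSpace (S N : Submodule (ZMod 3) (ι → ZMod 3)) :
    ∃ G, cssSpace S N = fixedSpace G := ⟨_, cssSpace_eq_cssCode S N⟩

/-! ### Logical Pauli operators -/

lemma indicator_mem_cssSpace {S N : Submodule (ZMod 3) (ι → ZMod 3)} (hSN : S ≤ N)
    {y : ι → ZMod 3} (hy : y ∈ N) [DecidablePred fun x => x - y ∈ S] :
    (fun x => if x - y ∈ S then (1 : ℂ) else 0) ∈ cssSpace S N := by
  refine ⟨fun x hx => ?_, fun s hs x => ?_⟩
  · have h : x - y ∈ S := by by_contra h; simp [h] at hx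
    simpa using N.add_mem (hSN h) hy
  · have : x + s - y ∈ S ↔ x - y ∈ S := by
      rw [add_sub_right_comm]
      exact S.add_mem_iff_left hs
    simp only [this]

/-- The test state is the indicator of `S`. Its image is non-zero at `u`, which forces `u ∈ N`, and
comparing its values at `u` and `u + s` forces `v ⬝ᵥ s = 0`. If `u ∈ S` and `v` is orthogonal to
`N`, the operator acts as the scalar 1. -/
lemma IsNontrivialLogical.cssSpace {S N : Submodule (ZMod 3) (ι → ZMod 3)} (hSN : S ≤ N)
    {u v : ι → ZMod 3} (h : IsNontrivialLogical (cssSpace S N) u v) :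
    u ∈ N ∧ (∀ s ∈ S, v ⬝ᵥ s = 0) ∧ ¬(u ∈ S ∧ ∀ y ∈ N, v ⬝ᵥ y = 0) := by
  classical
  obtain ⟨h1, h2⟩ := h
  have hI := h1 _ (indicator_mem_cssSpace hSN N.zero_mem)
  refine ⟨hI.1 u ?_, fun s hs => ?_, fun ⟨hu, hv⟩ => h2 ⟨1, fun ψ hψ => ?_⟩⟩
  · rw [pauli_mulVec_apply]
    simp [chi_zero]
  · have := hI.2 s hs u
    rw [pauli_mulVec_apply, pauli_mulVec_apply] at this
    simpa [hs, chi_zero, chi_eq_one_iff] using this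
  · ext x
    have hx := hψ.2 u hu (x - u)
    rw [sub_add_cancel] at hx
    rw [pauli_mulVec_apply, ← hx, zero_add, one_smul]
    by_cases h0 : ψ x = 0
    · rw [h0, mul_zero]
    · rw [hv _ (hψ.1 _ (hx ▸ h0)), chi_zero, one_mul]

/-- The indicators of `S` and of `y + S` are code states with different eigenvalues, 1 and `chi (v
⬝ᵥ y)`. Only Z-type operators are needed, since all three distances are attained by one. -/
lemma isNontrivialLogical_cssSpace {S N : Submodule (ZMod 3) (ι → ZMod 3)} (hSN : S ≤ N)
    {v y : ι → ZMod 3} (hS : ∀ s ∈ S, v ⬝ᵥ s = 0) (hy : y ∈ N) (hv : v ⬝ᵥ y ≠ 0) :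
    IsNontrivialLogical (cssSpace S N) 0 v := by
  classical
  refine ⟨fun ψ hψ => ⟨fun x hx => hψ.1 x fun h => hx ?_, fun s hs x => ?_⟩, ?_⟩
  · rw [pauli_mulVec_apply, sub_zero, h, mul_zero]
  · rw [pauli_mulVec_apply, pauli_mulVec_apply, sub_zero, sub_zero, hψ.2 s hs, dotProduct_add,
      hS s hs, add_zero]
  · rintro ⟨z, hz⟩
    have e0 := congrFun (hz _ (indicator_mem_cssSpace hSN N.zero_mem)) 0
    have ey := congrFun (hz _ (indicator_mem_cssSpace hSN hy)) y
    rw [pauli_mulVec_apply] at e0 ey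
    simp [chi_zero] at e0 ey
    rw [← e0] at ey
    exact hv ((chi_eq_one_iff _).1 ey)

/-! ### Distance of a CSS code -/

lemma card_support_le_pauliWeight_left (u v : ι → ZMod 3) :
    (Finset.univ.filter fun i => u i ≠ 0).card ≤ pauliWeight u v :=
  Finset.card_le_card fun i hi => by
    simp only [Finset.mem_filter, Finset.mem_univ, true_and] at hi ⊢
    exact Or.inl hi

lemma card_support_le_pauliWeight_right (u v : ι → ZMod 3) :
    (Finset.univ.filter fun i => v i ≠ 0).card ≤ pauliWeight u v :=
  Finset.card_le_card fun i hi => by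
    simp only [Finset.mem_filter, Finset.mem_univ, true_and] at hi ⊢
    exact Or.inr hi

/-- A criterion for the distance of a CSS code. -/
lemma isLeast_logicalWeights {S N : Submodule (ZMod 3) (ι → ZMod 3)} (hSN : S ≤ N) {d : ℕ}
    (hX : ∀ u ∈ N, u ∉ S → d ≤ (Finset.univ.filter fun i => u i ≠ 0).card)
    (hZ : ∀ v : ι → ZMod 3, (∀ s ∈ S, v ⬝ᵥ s = 0) → (∃ y ∈ N, v ⬝ᵥ y ≠ 0) →
      d ≤ (Finset.univ.filter fun i => v i ≠ 0).card)
    {v y : ι → ZMod 3} (hS : ∀ s ∈ S, v ⬝ᵥ s = 0) (hy : y ∈ N) (hv : v ⬝ᵥ y ≠ 0)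
    (hd : (Finset.univ.filter fun i => v i ≠ 0).card = d) :
    IsLeast (logicalWeights (cssSpace S N)) d := by
  refine ⟨⟨0, v, isNontrivialLogical_cssSpace hSN hS hy hv, ?_⟩, ?_⟩
  · simpa [pauliWeight] using hd
  · rintro w ⟨u, v, h, rfl⟩
    obtain ⟨hu, hvS, hn⟩ := h.cssSpace hSN
    by_cases huS : u ∈ S
    · refine (hZ v hvS ?_).trans (card_support_le_pauliWeight_right u v)
      by_contra! hc
      exact hn ⟨huS, hc⟩
    · exact (hX u hu huS).trans (card_support_le_pauliWeight_left u v)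

lemma two_le_card_support {v : ι → ZMod 3} (h0 : v ≠ 0)
    (h1 : ∀ i a, a ≠ 0 → v ≠ Pi.single i a) :
    2 ≤ (Finset.univ.filter fun i => v i ≠ 0).card := by
  by_contra! hlt
  obtain ⟨i, hi⟩ := Function.ne_iff.1 h0
  have hmem : ∀ j, v j ≠ 0 → j = i := fun j hj =>
    Finset.card_le_one.1 (Nat.lt_succ_iff.1 hlt) j (by simpa using hj) i (by simpa using hi)
  refine h1 i (v i) hi (funext fun j => ?_)
  by_cases hj : j = i
  · subst hj; simp
  · rw [Pi.single_eq_of_ne hj]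
    by_contra h
    exact hj (hmem j h)

/-! ### Encoders -/

lemma IsEncoder.finrank {A : Type} [Fintype A] [DecidableEq A] {E : Matrix (ι → ZMod 3) A ℂ}
    {C : Submodule ℂ ((ι → ZMod 3) → ℂ)} (h : IsEncoder E C) :
    Module.finrank ℂ C = Fintype.card A := by
  rw [← h.2, LinearMap.finrank_range_of_inj, Module.finrank_fintype_fun_eq_card]
  intro φ ψ hφ
  have : Eᴴ *ᵥ (E *ᵥ φ) = Eᴴ *ᵥ (E *ᵥ ψ) := congrArg _ hφ
  simpa [Matrix.mulVec_mulVec, h.1] using this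

lemma IsEncoder.mul_unitary {A : Type} [Fintype A] [DecidableEq A] {E : Matrix (ι → ZMod 3) A ℂ}
    {C : Submodule ℂ ((ι → ZMod 3) → ℂ)} (h : IsEncoder E C) {U : Matrix A A ℂ}
    (hU : Uᴴ * U = 1) : IsEncoder (E * U) C := by
  refine ⟨?_, ?_⟩
  · rw [Matrix.conjTranspose_mul, Matrix.mul_assoc, ← Matrix.mul_assoc Eᴴ, h.1, Matrix.one_mul, hU]
  · rw [← h.2, Matrix.mulVecLin_mul, LinearMap.range_comp_of_range_eq_top]
    rw [LinearMap.range_eq_top]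
    intro φ
    exact ⟨Uᴴ *ᵥ φ, by simp [Matrix.mulVec_mulVec, mul_eq_one_comm.1 hU]⟩

lemma cssEncoder_apply {A : Type} (S : Submodule (ZMod 3) (ι → ZMod 3)) (ℓ : A → ι → ZMod 3)
    (x : ι → ZMod 3) (a : A) [Decidable (x - ℓ a ∈ S)] :
    cssEncoder S ℓ x a = if x - ℓ a ∈ S then ((Real.sqrt (Nat.card S))⁻¹ : ℂ) else 0 := by
  rw [cssEncoder, Matrix.of_apply]
  congr

lemma sqrt_natCard_ne_zero (S : Submodule (ZMod 3) (ι → ZMod 3)) :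
    ((Real.sqrt (Nat.card S) : ℝ) : ℂ) ≠ 0 := by
  rw [Complex.ofReal_ne_zero]
  exact (Real.sqrt_pos.2 (by exact_mod_cast Nat.card_pos)).ne'

/-- The hypotheses say that `ℓ` is a system of representatives of `N / S`, so the columns are
normalised indicators of disjoint cosets covering `N`. -/
lemma isEncoder_cssEncoder {A : Type} [Fintype A] [DecidableEq A]
    {S N : Submodule (ZMod 3) (ι → ZMod 3)} (hSN : S ≤ N) {ℓ : A → ι → ZMod 3}
    (hℓ : ∀ a, ℓ a ∈ N) (hinj : ∀ a b, ℓ a - ℓ b ∈ S → a = b)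
    (hsurj : ∀ x ∈ N, ∃ a, x - ℓ a ∈ S) : IsEncoder (cssEncoder S ℓ) (cssSpace S N) := by
  classical
  have huniq : ∀ x a b, x - ℓ a ∈ S → x - ℓ b ∈ S → a = b := fun x a b ha hb => hinj a b (by
    have := S.sub_mem hb ha
    rwa [sub_sub_sub_cancel_left] at this)
  refine ⟨?_, le_antisymm ?_ ?_⟩
  · ext a b
    rw [Matrix.mul_apply]
    by_cases hab : a = b
    · subst hab
      have hs : ∀ x, (cssEncoder S ℓ)ᴴ a x * cssEncoder S ℓ x a
          = if x - ℓ a ∈ S then ((Nat.card S : ℂ))⁻¹ else 0 := by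
        intro x
        rw [Matrix.conjTranspose_apply, cssEncoder_apply]
        split_ifs
        · rw [star_inv₀, ← mul_inv]
          congr 1
          rw [Complex.star_def, Complex.conj_ofReal, ← Complex.ofReal_mul,
            Real.mul_self_sqrt (Nat.cast_nonneg _), Complex.ofReal_natCast]
        · simp
      simp only [hs]
      refine ((Equiv.subRight (ℓ a)).sum_comp
        (fun x => if x ∈ S then ((Nat.card S : ℂ))⁻¹ else 0)).trans ?_
      rw [← Finset.sum_filter, Finset.sum_const, ← Fintype.card_subtype, nsmul_eq_mul,
        Matrix.one_apply_eq, ← Nat.card_eq_fintype_card]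
      exact mul_inv_cancel₀ (Nat.cast_ne_zero.2 Nat.card_pos.ne')
    · rw [Matrix.one_apply_ne hab]
      refine Finset.sum_eq_zero fun x _ => ?_
      rw [Matrix.conjTranspose_apply, cssEncoder_apply, cssEncoder_apply]
      by_cases ha : x - ℓ a ∈ S
      · by_cases hb : x - ℓ b ∈ S
        · exact absurd (huniq x a b ha hb) hab
        · simp [hb]
      · simp [ha]
  · rintro _ ⟨φ, rfl⟩
    have : (cssEncoder S ℓ).mulVecLin φ = ∑ a, (φ a * (Real.sqrt (Nat.card S) : ℂ)⁻¹) •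
        (fun x => if x - ℓ a ∈ S then (1 : ℂ) else 0) := by
      ext x
      simp [Matrix.mulVec, dotProduct, cssEncoder_apply, mul_comm]
    rw [this]
    exact Submodule.sum_mem _ fun a _ =>
      Submodule.smul_mem _ _ (indicator_mem_cssSpace hSN (hℓ a))
  · intro ψ hψ
    -- A code state is constant on each coset, so its value at the representative, rescaled, is the
    -- coefficient.
    refine ⟨fun a => (Real.sqrt (Nat.card S) : ℂ) * ψ (ℓ a), funext fun x => ?_⟩
    rw [Matrix.mulVecLin_apply, Matrix.mulVec, dotProduct]
    by_cases hx : ∃ a, x - ℓ a ∈ S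
    · obtain ⟨a, ha⟩ := hx
      rw [Finset.sum_eq_single_of_mem a (Finset.mem_univ a)]
      · have := hψ.2 _ ha (ℓ a)
        rw [add_sub_cancel] at this
        rw [cssEncoder_apply, if_pos ha, this, inv_mul_cancel_left₀ (sqrt_natCard_ne_zero S)]
      · intro b _ hba
        rw [cssEncoder_apply, if_neg (fun hb => hba (huniq x b a hb ha)), zero_mul]
    · rw [Finset.sum_eq_zero fun a _ => by
        rw [cssEncoder_apply, if_neg fun ha => hx ⟨a, ha⟩, zero_mul]]
      by_contra h
      exact hx (hsurj x (hψ.1 x (Ne.symm h)))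

end Register

section Register

variable {ι : Type} [Fintype ι] [DecidableEq ι]

/-! ### Gates acting through a CSS encoder -/

lemma mul_pauli_apply {A : Type} (M : Matrix A (ι → ZMod 3) ℂ) (c : ZMod 3) (u v : ι → ZMod 3)
    (a : A) (y : ι → ZMod 3) : (M * pauli c u v) a y = M a (y + u) * chi (c + v ⬝ᵥ y) := by
  rw [pauli, Matrix.mul_smul, ← Matrix.mul_assoc, Matrix.smul_apply, mul_zOp_apply, mul_xOp_apply,
    chi_add, smul_eq_mul]
  ring

/-- `X^u` permutes the cosets as `u'` shifts their labels, and by `hS` the phase of `Z^v` is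
constant on each coset. -/
lemma pauli_mul_cssEncoder {κ : Type} [Fintype κ] [DecidableEq κ]
    {S : Submodule (ZMod 3) (ι → ZMod 3)}
    {ℓ : (κ → ZMod 3) → ι → ZMod 3} {u v : ι → ZMod 3} {u' v' : κ → ZMod 3} (c : ZMod 3)
    (hS : ∀ s ∈ S, v ⬝ᵥ s = 0) (hu : ∀ a, ℓ (a + u') = ℓ a + u)
    (hv : ∀ a, v ⬝ᵥ ℓ a = v' ⬝ᵥ a) :
    pauli c u v * cssEncoder S ℓ = cssEncoder S ℓ * pauli c u' v' := by
  classical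
  ext x a
  rw [pauli_mul_apply, mul_pauli_apply, cssEncoder_apply, cssEncoder_apply, hu,
    ← sub_sub, sub_right_comm x (ℓ a) u]
  split_ifs with h
  · have := hS _ h
    rw [dotProduct_sub, hv, sub_eq_zero] at this
    rw [this, mul_comm]
  · simp

lemma diagonal_mul_cssEncoder {A : Type} [Fintype A] [DecidableEq A]
    {S : Submodule (ZMod 3) (ι → ZMod 3)} {ℓ : A → ι → ZMod 3} {d : (ι → ZMod 3) → ℂ} {e : A → ℂ}
    (h : ∀ a, ∀ s ∈ S, d (ℓ a + s) = e a) :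
    Matrix.diagonal d * cssEncoder S ℓ = cssEncoder S ℓ * Matrix.diagonal e := by
  classical
  ext x a
  rw [Matrix.diagonal_mul, Matrix.mul_diagonal, cssEncoder_apply]
  split_ifs with hx
  · rw [← h a _ hx, add_sub_cancel, mul_comm]
  · simp

lemma tensorGate_mul (U V : ι → Matrix (ZMod 3) (ZMod 3) ℂ) :
    tensorGate U * tensorGate V = tensorGate fun i => U i * V i := by
  ext x y
  simp only [Matrix.mul_apply, tensorGate, Matrix.of_apply, Fintype.prod_sum,
    Finset.prod_mul_distrib]

lemma conjTranspose_tensorGate (U : ι → Matrix (ZMod 3) (ZMod 3) ℂ) :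
    (tensorGate U)ᴴ = tensorGate fun i => (U i)ᴴ := by
  ext x y
  simp [tensorGate]

lemma tensorGate_diagonal (d : ι → ZMod 3 → ℂ) :
    tensorGate (fun i => Matrix.diagonal (d i)) = Matrix.diagonal fun x => ∏ i, d i (x i) := by
  ext x y
  rw [tensorGate, Matrix.of_apply]
  by_cases h : x = y
  · subst h; simp
  · obtain ⟨i, hi⟩ := Function.ne_iff.1 h
    rw [Matrix.diagonal_apply_ne _ h]
    exact Finset.prod_eq_zero (Finset.mem_univ i) (Matrix.diagonal_apply_ne _ hi)

lemma tensorGate_one : tensorGate (fun _ : ι => (1 : Matrix (ZMod 3) (ZMod 3) ℂ)) = 1 := by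
  have := tensorGate_diagonal (fun _ : ι => fun _ => 1)
  simpa using this

/-! ### Phases of the `T` gate -/

/-- The exponent of `exp (2πi/9)` in the diagonal entries of `T`. -/
def tExp (k : ZMod 3) : ZMod 9 := if k = 0 then 0 else if k = 1 then 1 else -1

/-- Phases become values of an additive character of `ZMod 9`, and `tExp k` is `k ^ 3` modulo 9;
products of phases turn into finite sums that can be decided. -/
lemma tGate_eq_diagonal : tGate = Matrix.diagonal fun k => ZMod.stdAddChar (tExp k) := by
  rw [tGate]
  congr 1
  ext k
  simp only [tExp]
  split_ifs
  · simp
  · have := ZMod.stdAddChar_coe (N := 9) 1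
    push_cast at this
    rw [this]; simp
  · have := ZMod.stdAddChar_coe (N := 9) (-1)
    push_cast at this
    rw [this]; congr 1; ring

lemma conjTranspose_tGate : tGateᴴ = Matrix.diagonal fun k => ZMod.stdAddChar (-tExp k) := by
  rw [tGate_eq_diagonal, Matrix.diagonal_conjTranspose]
  congr 1
  ext k
  rw [AddChar.map_neg_eq_conj]
  rfl

lemma stdAddChar_sum (f : ι → ZMod 9) :
    ∏ i, (ZMod.stdAddChar (f i) : ℂ) = ZMod.stdAddChar (∑ i, f i) :=
  (map_prod (ZMod.stdAddChar (N := 9)).toMonoidHom (fun i => Multiplicative.ofAdd (f i))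
    Finset.univ).symm

lemma tLayer_eq_diagonal (A : Finset ι) : tLayer A = Matrix.diagonal fun x =>
    ZMod.stdAddChar (∑ i, if i ∈ A then tExp (x i) else -tExp (x i)) := by
  have : (fun i : ι => if i ∈ A then tGate else tGateᴴ) = fun i => Matrix.diagonal fun k =>
      ZMod.stdAddChar (if i ∈ A then tExp k else -tExp k) := by
    ext1 i
    split_ifs
    · exact tGate_eq_diagonal
    · exact conjTranspose_tGate
  rw [tLayer, this, tensorGate_diagonal]
  congr 1
  ext x
  exact stdAddChar_sum _

/-- The embedding of `ZMod 3` in `ZMod 9` with `1 ↦ 3`. -/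
def tripleNine (k : ZMod 3) : ZMod 9 := 3 * tExp k

lemma stdAddChar_tripleNine (k : ZMod 3) : (ZMod.stdAddChar (tripleNine k) : ℂ) = chi k := by
  have h1 : (ZMod.stdAddChar (3 : ZMod 9) : ℂ) = chi 1 := by
    have h := ZMod.stdAddChar_coe (N := 9) 3
    have h' := ZMod.stdAddChar_coe (N := 3) 1
    push_cast at h h'
    rw [chi_eq_stdAddChar, h, h']
    congr 1
    ring
  have hk : ∀ k : ZMod 3, k = 0 ∨ k = 1 ∨ k = 2 := by decide
  obtain rfl | rfl | rfl := hk k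
  · rw [chi_zero, show tripleNine 0 = 0 by decide, AddChar.map_zero_eq_one]
  · rw [show tripleNine 1 = 3 by decide, h1]
  · have e : tripleNine 2 = 3 + 3 := by decide
    have e' : (2 : ZMod 3) = 1 + 1 := by decide
    rw [e, e', AddChar.map_add_eq_mul, chi_add, h1]

end Register

/-! ### Small gates -/

lemma conjTranspose_mul_self_of_injective {A : Type} [Fintype A] [DecidableEq A] {f : A → A}
    (hf : Function.Injective f) :
    (Matrix.of fun x y => if x = f y then (1 : ℂ) else 0)ᴴ *
      (Matrix.of fun x y => if x = f y then (1 : ℂ) else 0) = 1 := by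
  ext x y
  simp [Matrix.mul_apply, Matrix.one_apply, hf.eq_iff, eq_comm]

lemma andGate_mulVec_single (y : Fin 2 → ZMod 3) : andGate *ᵥ Pi.single y 1 =
    Pi.single (if y 1 = y 0 + 1 then ![y 0 - 1, y 1 - 1] else y) 1 := by
  ext x
  simp [andGate, Pi.single_apply]

lemma andGate_unitary : andGateᴴ * andGate = 1 := by
  refine conjTranspose_mul_self_of_injective
    (f := fun y => if y 1 = y 0 + 1 then ![y 0 - 1, y 1 - 1] else y) ?_
  intro x y h
  have h0 := congrFun h 0
  have h1 := congrFun h 1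
  ext i
  fin_cases i <;> simp only [] at h0 h1 ⊢ <;> split_ifs at h0 h1 <;> simp_all <;> grind

lemma emulatesAnd_andGate : EmulatesAnd andGate := by
  intro a b
  rw [andGate_mulVec_single]
  cases a <;> cases b
  · exact ⟨0, by congr 1⟩
  · exact ⟨2, by congr 1⟩
  · exact ⟨1, by congr 1⟩
  · exact ⟨1, by congr 1⟩

lemma xGate_unitary : xGateᴴ * xGate = 1 :=
  conjTranspose_mul_self_of_injective (add_left_injective 1)

lemma sum_chi_mul (a : ZMod 3) : ∑ j, chi (j * a) = if a = 0 then 3 else 0 := by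
  simp only [chi_eq_stdAddChar]
  have := AddChar.sum_mulShift a (ZMod.isPrimitive_stdAddChar 3)
  rw [this, ZMod.card]
  norm_cast

lemma inv_sqrt_three_mul_self : ((Real.sqrt 3 : ℝ) : ℂ)⁻¹ * ((Real.sqrt 3 : ℝ) : ℂ)⁻¹ = 3⁻¹ := by
  rw [← mul_inv, ← Complex.ofReal_mul, Real.mul_self_sqrt (by norm_num)]
  norm_num

lemma hGate_mul_conjTranspose : hGate * hGateᴴ = 1 := by
  ext a b
  have h : ∀ j, hGate a j * hGateᴴ j b = 3⁻¹ * chi (j * (a - b)) := by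
    intro j
    rw [Matrix.conjTranspose_apply, hGate, Matrix.of_apply, Matrix.of_apply, star_mul', star_chi,
      star_inv₀, Complex.star_def, Complex.conj_ofReal, mul_mul_mul_comm, inv_sqrt_three_mul_self,
      ← chi_add]
    congr 2
    ring
  rw [Matrix.mul_apply, Finset.sum_congr rfl fun j _ => h j, ← Finset.mul_sum, sum_chi_mul,
    Matrix.one_apply]
  simp [sub_eq_zero]

lemma cxGate_unitary : cxGateᴴ * cxGate = 1 := by
  refine conjTranspose_mul_self_of_injective (f := fun y => ![y 0 + y 1, y 1]) ?_
  intro x y h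
  have h0 := congrFun h 0
  have h1 := congrFun h 1
  ext i
  fin_cases i <;> simp at h0 h1 ⊢ <;> simp_all

/-- The logical Clifford gate in the encoder of the outer code. -/
def outerClifford : Matrix (Fin 2 → ZMod 3) (Fin 2 → ZMod 3) ℂ :=
  tensorGate ![xGate, hGateᴴ] * cxGateᴴ

lemma outerClifford_unitary : outerCliffordᴴ * outerClifford = 1 := by
  have h : (tensorGate ![xGate, hGateᴴ])ᴴ * tensorGate ![xGate, hGateᴴ] = 1 := by
    rw [conjTranspose_tensorGate, tensorGate_mul, ← tensorGate_one]
    congr 1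
    ext1 i
    fin_cases i
    · exact xGate_unitary
    · simpa using hGate_mul_conjTranspose
  rw [outerClifford, Matrix.conjTranspose_mul, Matrix.mul_assoc, ← Matrix.mul_assoc _ _ cxGateᴴ, h,
    Matrix.one_mul, Matrix.conjTranspose_conjTranspose]
  exact mul_eq_one_comm.1 cxGate_unitary

/-- `CX†` replaces `y` by `(y 0 - y 1, y 1)`, `X` adds one to the first entry, and `H†` spreads the
second with phases. -/
lemma outerClifford_apply (x y : Fin 2 → ZMod 3) : outerClifford x y =
    if x 0 = y 0 - y 1 + 1 then (Real.sqrt 3 : ℂ)⁻¹ * chi (-(x 1 * y 1)) else 0 := by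
  have h : ∀ z, cxGateᴴ z y = if z = ![y 0 - y 1, y 1] then 1 else 0 := by
    intro z
    have : y = ![z 0 + z 1, z 1] ↔ z = ![y 0 - y 1, y 1] := by
      constructor
      · intro h; ext i; fin_cases i <;> simp [h]
      · intro h; ext i; fin_cases i <;> simp [h]
    rw [Matrix.conjTranspose_apply, cxGate, Matrix.of_apply, apply_ite star, star_one, star_zero]
    simp only [this]
  rw [outerClifford, Matrix.mul_apply]
  simp only [h, mul_ite, mul_one, mul_zero]
  rw [Finset.sum_ite_eq' Finset.univ, if_pos (Finset.mem_univ _)]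
  simp only [tensorGate, Matrix.of_apply, Fin.prod_univ_two, xGate, hGate, Matrix.cons_val_zero,
    Matrix.cons_val_one, Matrix.conjTranspose_apply, star_mul', star_chi, star_inv₀,
    Complex.star_def, Complex.conj_ofReal, ite_mul, one_mul, zero_mul, mul_comm (y 1)]

/-- `h0` matches the supports of the two sides. On the support `x 0` is determined by `y` and `u'`;
after eliminating it, `h` equates the exponents of `ω`, a finite check for concrete Paulis. -/
lemma pauli_mul_outerClifford {c : ZMod 3} {u v u' v' : Fin 2 → ZMod 3}
    (h0 : u 0 = u' 0 - u' 1)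
    (h : ∀ x1 y0 y1 : ZMod 3, c + (v 0 * (y0 - y1 + u' 0 - u' 1 + 1 - u 0) + v 1 * (x1 - u 1))
      - (x1 - u 1) * y1 = v' 0 * y0 + v' 1 * y1 - x1 * (y1 + u' 1)) :
    pauli c u v * outerClifford = outerClifford * pauli 0 u' v' := by
  ext x y
  rw [pauli_mul_apply, mul_pauli_apply, outerClifford_apply, outerClifford_apply]
  have hc : (x - u) 0 = y 0 - y 1 + 1 ↔ x 0 = (y + u') 0 - (y + u') 1 + 1 := by
    simp only [Pi.sub_apply, Pi.add_apply, h0]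
    constructor <;> intro h <;> linear_combination h
  simp only [← hc]
  split_ifs with hx
  · rw [mul_left_comm, mul_assoc, ← chi_add, ← chi_add]
    congr 2
    have := h (x 1) (y 0) (y 1)
    have hx' := hc.1 hx
    simp only [Pi.add_apply] at hx'
    simp only [dotProduct, Fin.sum_univ_two, Pi.sub_apply, Pi.add_apply]
    linear_combination this + v 0 * hx'
  · simp

/-- On the support, `x 0 = 0` means `y 1 = y 0 + 1`. There the phase `chi (x 1)` turns `chi (-(x 1 *
y 1))` into `chi (-(x 1 * (y 1 - 1)))`, lowering `y 1` by one; `y 0` drops too because `x 0` fixes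
the difference. -/
lemma diagonal_mul_outerClifford :
    Matrix.diagonal (fun a : Fin 2 → ZMod 3 => if a 0 = 0 then chi (a 1) else 1) * outerClifford =
      outerClifford * andGate := by
  ext x y
  rw [Matrix.diagonal_mul, Matrix.mul_apply]
  simp only [andGate, Matrix.of_apply, mul_ite, mul_one, mul_zero]
  rw [Finset.sum_ite_eq' Finset.univ, if_pos (Finset.mem_univ _), outerClifford_apply,
    outerClifford_apply]
  by_cases hy : y 1 = y 0 + 1
  · have e : x 0 = y 0 - y 1 + 1 ↔ x 0 = 0 := by rw [hy]; ring_nf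
    simp only [if_pos hy, Matrix.cons_val_zero, Matrix.cons_val_one, sub_sub_sub_cancel_right, e]
    split_ifs
    · rw [mul_left_comm, ← chi_add]
      congr 2
      ring
    · simp
  · simp only [if_neg hy]
    by_cases hx : x 0 = y 0 - y 1 + 1
    · rw [if_neg, one_mul]
      rw [hx]
      intro h
      exact hy (by linear_combination -h)
    · simp [hx]

/-! ### The outer code -/

/-- The X-type stabilizer space of the outer code. -/
def outerS : Submodule (ZMod 3) (Fin 6 → ZMod 3) := Submodule.span (ZMod 3) {![1, 1, 1, 1, 1, 1]}

/-- The vectors orthogonal to the Z-type stabilizers of the outer code. -/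
def outerN : Submodule (ZMod 3) (Fin 6 → ZMod 3) :=
  dotPerp {![1, 1, 1, 0, 0, 0], ![0, 1, 2, 2, 1, 0], ![0, 0, 0, 1, 1, 1]}

/-- The logical shifts of the outer code. -/
def outerShift (a : Fin 2 → ZMod 3) : Fin 6 → ZMod 3 :=
  a 0 • ![2, 1, 0, 2, 1, 0] + a 1 • ![1, 1, 1, 0, 0, 0]

lemma outerCode_eq : outerCode = cssSpace outerS outerN := cssCode_eq_cssSpace _ _

lemma outerEncoder_eq : outerEncoder = cssEncoder outerS outerShift * outerClifford := by
  rw [outerEncoder, Matrix.mul_assoc]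
  rfl

lemma mem_outerS {x : Fin 6 → ZMod 3} : x ∈ outerS ↔ ∃ s : ZMod 3, ∀ i, x i = s := by
  rw [outerS, Submodule.mem_span_singleton]
  refine exists_congr fun s => ?_
  rw [eq_comm, funext_iff]
  refine forall_congr' fun i => ?_
  fin_cases i <;> simp

lemma mem_outerN {x : Fin 6 → ZMod 3} : x ∈ outerN ↔
    x 0 + x 1 + x 2 = 0 ∧ x 1 + 2 * x 2 + 2 * x 3 + x 4 = 0 ∧ x 3 + x 4 + x 5 = 0 := by
  simp [outerN, mem_dotPerp, dotProduct, Fin.sum_univ_succ, add_assoc]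

lemma outerShift_apply (a : Fin 2 → ZMod 3) : outerShift a =
    ![2 * a 0 + a 1, a 0 + a 1, a 1, 2 * a 0, a 0, 0] := by
  ext i
  fin_cases i <;> simp [outerShift, mul_comm]

lemma outerS_le_outerN : outerS ≤ outerN := by
  intro x hx
  obtain ⟨s, hs⟩ := mem_outerS.1 hx
  simp only [mem_outerN, hs]
  clear hs
  revert s
  decide

lemma outerShift_mem (a : Fin 2 → ZMod 3) : outerShift a ∈ outerN := by
  rw [mem_outerN, outerShift_apply]
  simp only [Matrix.cons_val]
  grind

lemma isEncoder_outerCss : IsEncoder (cssEncoder outerS outerShift) outerCode := by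
  rw [outerCode_eq]
  refine isEncoder_cssEncoder outerS_le_outerN outerShift_mem ?_ ?_
  · intro a b h
    obtain ⟨s, hs⟩ := mem_outerS.1 h
    have h2 := hs 2
    have h4 := hs 4
    have h5 := hs 5
    simp only [outerShift_apply, Pi.sub_apply, Matrix.cons_val] at h2 h4 h5
    ext i
    fin_cases i
    · change a 0 = b 0
      linear_combination h4 - h5
    · change a 1 = b 1
      linear_combination h2 - h5
  · intro x hx
    obtain ⟨h1, h2, h3⟩ := mem_outerN.1 hx
    -- The shift by `a` has entries `a 1`, `a 0`, `0` at positions 2, 4, 5, so position 5 gives the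
    -- stabilizer part and the other two give `a`.
    refine ⟨![x 4 - x 5, x 2 - x 5], mem_outerS.2 ⟨x 5, fun i => ?_⟩⟩
    rw [outerShift_apply]
    fin_cases i <;> simp <;> grind

lemma isEncoder_outerEncoder : IsEncoder outerEncoder outerCode := by
  rw [outerEncoder_eq]
  exact isEncoder_outerCss.mul_unitary outerClifford_unitary

lemma two_le_card_support_of_mem_outerN {y : Fin 6 → ZMod 3} (hy : y ∈ outerN) (h0 : y ≠ 0) :
    2 ≤ (Finset.univ.filter fun i => y i ≠ 0).card := by
  refine two_le_card_support h0 fun i a ha h => ?_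
  subst h
  rw [mem_outerN] at hy
  revert i a
  decide

lemma isLeast_logicalWeights_outerCode : IsLeast (logicalWeights outerCode) 2 := by
  rw [outerCode_eq]
  refine isLeast_logicalWeights outerS_le_outerN (v := ![1, 2, 0, 0, 0, 0])
    (y := outerShift ![1, 0]) ?_ ?_ ?_ (outerShift_mem _) ?_ (by decide)
  · intro u hu huS
    refine two_le_card_support_of_mem_outerN hu ?_
    rintro rfl
    exact huS outerS.zero_mem
  · rintro v hv ⟨y, -, hy⟩
    refine two_le_card_support (fun h => hy (by rw [h, zero_dotProduct])) fun i a ha h => ha ?_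
    have := hv (fun _ => 1) (mem_outerS.2 ⟨1, fun _ => rfl⟩)
    rwa [h, single_dotProduct, mul_one] at this
  · intro s hs
    obtain ⟨c, hc⟩ := mem_outerS.1 hs
    simp only [dotProduct, hc]
    clear hc
    revert c
    decide
  · decide

/-! ### Logical gates of the outer code -/

lemma implements_outer {u v : Fin 6 → ZMod 3} {c : ZMod 3} (u' v' : Fin 2 → ZMod 3)
    {L : Matrix (Fin 2 → ZMod 3) (Fin 2 → ZMod 3) ℂ}
    (hS : ∑ i, v i = 0) (hu : outerShift u' = u) (hv : ∀ a, v ⬝ᵥ outerShift a = v' ⬝ᵥ a)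
    (hL : pauli c u' v' * outerClifford = outerClifford * L) :
    Implements outerEncoder (pauli c u v) L := by
  -- The physical Pauli crosses the CSS encoder as `ω^c X^u' Z^v'`; `hL` then carries it through the
  -- Clifford gate.
  rw [Implements, outerEncoder_eq, ← Matrix.mul_assoc,
    pauli_mul_cssEncoder c (u' := u') (v' := v') ?_ ?_ hv, Matrix.mul_assoc, hL, Matrix.mul_assoc]
  · intro s hs
    obtain ⟨c, hc⟩ := mem_outerS.1 hs
    rw [funext hc, dotProduct, ← Finset.sum_mul, hS, zero_mul]
  · intro a
    rw [← hu]
    simp only [outerShift, Pi.add_apply, add_smul]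
    abel

lemma xOp_eq_pauli {ι : Type} [Fintype ι] [DecidableEq ι] (u : ι → ZMod 3) :
    xOp u = pauli 0 u 0 := by
  have : zOp (0 : ι → ZMod 3) = 1 := by simp [zOp, chi_zero]
  rw [pauli, chi_zero, one_smul, this, Matrix.mul_one]

lemma zOp_eq_pauli {ι : Type} [Fintype ι] [DecidableEq ι] (v : ι → ZMod 3) :
    zOp v = pauli 0 0 v := by
  have : xOp (0 : ι → ZMod 3) = 1 := by ext x y; simp [xOp, Matrix.one_apply]
  rw [pauli, chi_zero, one_smul, this, Matrix.one_mul]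

lemma implements_outer_x1 :
    Implements outerEncoder (pauli 0 ![2, 1, 0, 2, 1, 0] 0) (xOp ![1, 0]) := by
  refine implements_outer ![1, 0] 0 (by decide) (by decide) (by simp) ?_
  rw [xOp_eq_pauli]
  exact pauli_mul_outerClifford (by decide) (by decide)

/-- The factor `ω^2` arises from moving `Z` past the `X` gate of the encoder: `X Z X† = ω^2 Z`. -/
lemma implements_outer_z1 :
    Implements outerEncoder (pauli 2 ![1, 1, 1, 0, 0, 0] ![0, 0, 0, 1, 2, 0]) (zOp ![1, 0]) := by
  refine implements_outer ![0, 1] ![1, 0] (by decide) (by decide) (by decide) ?_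
  rw [zOp_eq_pauli]
  exact pauli_mul_outerClifford (by decide) (by decide)

lemma implements_outer_x2 :
    Implements outerEncoder (pauli 0 ![1, 2, 0, 1, 2, 0] ![0, 0, 2, 0, 0, 1]) (xOp ![0, 1]) := by
  refine implements_outer ![2, 0] ![0, 2] (by decide) (by decide) (by decide) ?_
  rw [xOp_eq_pauli]
  exact pauli_mul_outerClifford (by decide) (by decide)

lemma implements_outer_z2 :
    Implements outerEncoder (pauli 0 ![1, 1, 1, 0, 0, 0] 0) (zOp ![0, 1]) := by
  refine implements_outer ![0, 1] 0 (by decide) (by decide) (by simp) ?_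
  rw [zOp_eq_pauli]
  exact pauli_mul_outerClifford (by decide) (by decide)

/-- If `a 0 ≠ 0`, each half of the word runs through all of `ZMod 3` and its cubes sum to 0. If `a 0
= 0`, the sum is `3 (a 1 + s)^3 - 3 s^3`, which is `3 (a 1)` modulo 9. -/
lemma sum_tExp_outerShift (a : Fin 2 → ZMod 3) (s : ZMod 3) :
    (∑ i, if i ∈ ({0, 1, 2} : Finset (Fin 6)) then tExp (outerShift a i + s)
      else -tExp (outerShift a i + s)) = if a 0 = 0 then tripleNine (a 1) else 0 := by
  revert s
  revert a
  decide

lemma implements_outer_and : Implements outerEncoder (tLayer {0, 1, 2}) andGate := by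
  rw [Implements, outerEncoder_eq, ← Matrix.mul_assoc, tLayer_eq_diagonal,
    diagonal_mul_cssEncoder (e := fun a => if a 0 = 0 then chi (a 1) else 1), Matrix.mul_assoc,
    diagonal_mul_outerClifford, Matrix.mul_assoc]
  intro a s hs
  obtain ⟨c, hc⟩ := mem_outerS.1 hs
  simp only [Pi.add_apply, hc, sum_tExp_outerShift]
  split_ifs
  · exact stdAddChar_tripleNine _
  · exact AddChar.map_zero_eq_one _

/-! ### The inner code -/

/-- The X-type stabilizer space of the inner code: the linear functions on the plane. -/
def innerS : Submodule (ZMod 3) (Pt → ZMod 3) := Submodule.span (ZMod 3) innerX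

/-- The affine functions on the plane. -/
def innerN : Submodule (ZMod 3) (Pt → ZMod 3) :=
  innerS ⊔ Submodule.span (ZMod 3) {fun _ => 1}

/-- The logical shifts of the inner code. -/
def innerShift (k : ZMod 3) : Pt → ZMod 3 := fun _ => -k

lemma mem_innerS {x : Pt → ZMod 3} :
    x ∈ innerS ↔ ∃ α β : ZMod 3, ∀ p, x p = α * p.1.1 + β * p.1.2 := by
  rw [innerS, innerX, Submodule.mem_span_pair]
  refine exists_congr fun α => exists_congr fun β => ?_
  rw [eq_comm, funext_iff]
  rfl

lemma mem_innerN {x : Pt → ZMod 3} :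
    x ∈ innerN ↔ ∃ k : ZMod 3, x - innerShift k ∈ innerS := by
  rw [innerN, Submodule.mem_sup]
  constructor
  · rintro ⟨y, hy, z, hz, rfl⟩
    obtain ⟨c, rfl⟩ := Submodule.mem_span_singleton.1 hz
    refine ⟨-c, ?_⟩
    have : y + c • (fun _ => 1) - innerShift (-c) = y := by
      ext p; simp [innerShift]
    rwa [this]
  · rintro ⟨k, hk⟩
    refine ⟨_, hk, innerShift k, Submodule.mem_span_singleton.2 ⟨-k, ?_⟩, sub_add_cancel _ _⟩
    ext p; simp [innerShift]

/-- Affine functions are spanned by 1 and the two coordinates, so the three defining equations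
suffice; biduality then recovers `innerN`. -/
lemma innerZ_eq : innerZ = dotPerp (innerN : Set (Pt → ZMod 3)) := by
  ext v
  rw [SetLike.mem_coe, mem_dotPerp]
  constructor
  · rintro ⟨h1, h2, h3⟩ x hx
    obtain ⟨k, hk⟩ := mem_innerN.1 hx
    obtain ⟨α, β, h⟩ := mem_innerS.1 hk
    have hx : ∀ p, x p * v p = α * (v p * p.1.1) + β * (v p * p.1.2) - k * v p := by
      intro p
      have := h p
      simp only [innerShift, Pi.sub_apply] at this
      linear_combination v p * this
    simp only [dotProduct, hx, Finset.sum_add_distrib, Finset.sum_sub_distrib, ← Finset.mul_sum,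
      h1, h2, h3, mul_zero, add_zero, sub_zero]
  · intro h
    have h1 := h (fun _ => 1) (mem_innerN.2 ⟨-1, mem_innerS.2 ⟨0, 0, by simp [innerShift]⟩⟩)
    have h2 := h (fun p => p.1.1) (mem_innerN.2 ⟨0, mem_innerS.2 ⟨1, 0, by simp [innerShift]⟩⟩)
    have h3 := h (fun p => p.1.2) (mem_innerN.2 ⟨0, mem_innerS.2 ⟨0, 1, by simp [innerShift]⟩⟩)
    simp only [dotProduct, one_mul] at h1 h2 h3
    exact ⟨h1, by simpa [mul_comm] using h2, by simpa [mul_comm] using h3⟩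

lemma innerCode_eq : innerCode = cssSpace innerS innerN := by
  rw [innerCode, cssCode_eq_cssSpace, innerZ_eq, dotPerp_dotPerp]
  rfl

lemma innerS_le_innerN : innerS ≤ innerN := le_sup_left

lemma innerShift_mem_innerS {k : ZMod 3} (h : innerShift k ∈ innerS) : k = 0 := by
  obtain ⟨α, β, h⟩ := mem_innerS.1 h
  -- A linear function has opposite values at opposite points, whereas the constant `-k` gives the
  -- sum `-2k = k`.
  have h1 := h ⟨(1, 0), by decide⟩
  have h2 := h ⟨(-1, 0), by decide⟩
  simp only [innerShift] at h1 h2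
  grind

lemma innerShift_sub (a b : ZMod 3) : innerShift a - innerShift b = innerShift (a - b) := by
  ext p
  simp only [innerShift, Pi.sub_apply]
  ring

lemma isEncoder_innerEncoder : IsEncoder innerEncoder innerCode := by
  rw [innerCode_eq]
  refine isEncoder_cssEncoder (ℓ := innerShift) innerS_le_innerN (fun k => ?_) (fun a b h => ?_)
    fun x hx => mem_innerN.1 hx
  · exact mem_innerN.2 ⟨k, by rw [sub_self]; exact innerS.zero_mem⟩
  · rw [innerShift_sub] at h
    exact sub_eq_zero.1 (innerShift_mem_innerS h)

/-! ### Distance and logical gates of the inner code -/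

lemma two_le_card_support_of_perp_innerS {v : Pt → ZMod 3} (h0 : v ≠ 0)
    (hv : ∀ s ∈ innerS, v ⬝ᵥ s = 0) : 2 ≤ (Finset.univ.filter fun i => v i ≠ 0).card := by
  refine two_le_card_support h0 fun p a ha h => ?_
  have h1 := hv (fun p => p.1.1) (mem_innerS.2 ⟨1, 0, by simp⟩)
  have h2 := hv (fun p => p.1.2) (mem_innerS.2 ⟨0, 1, by simp⟩)
  rw [h, single_dotProduct] at h1 h2
  -- A weight-one vector killed by both coordinates would sit at the deleted origin.
  exact p.2 (Prod.ext ((mul_eq_zero.1 h1).resolve_left ha) ((mul_eq_zero.1 h2).resolve_left ha))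

lemma two_le_card_support_of_mem_innerN {x : Pt → ZMod 3} (hx : x ∈ innerN) (h0 : x ≠ 0) :
    2 ≤ (Finset.univ.filter fun i => x i ≠ 0).card := by
  obtain ⟨k, hk⟩ := mem_innerN.1 hx
  obtain ⟨α, β, h⟩ := mem_innerS.1 hk
  have h' : x = fun p => α * p.1.1 + β * p.1.2 - k := by
    ext p
    have := h p
    simp only [innerShift, Pi.sub_apply] at this
    linear_combination this
  subst h'
  clear hx hk h
  revert α β k
  decide

/-- A Z-type operator of weight two acting non-trivially on the inner code. -/
def innerLogical : Pt → ZMod 3 :=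
  Pi.single ⟨(1, 0), by decide⟩ 1 + Pi.single ⟨(2, 0), by decide⟩ 1

lemma innerLogical_dotProduct (x : Pt → ZMod 3) : innerLogical ⬝ᵥ x =
    x ⟨(1, 0), by decide⟩ + x ⟨(2, 0), by decide⟩ := by
  rw [innerLogical, add_dotProduct, single_dotProduct, single_dotProduct, one_mul, one_mul]

lemma innerLogical_perp {s : Pt → ZMod 3} (hs : s ∈ innerS) : innerLogical ⬝ᵥ s = 0 := by
  obtain ⟨α, β, h⟩ := mem_innerS.1 hs
  rw [innerLogical_dotProduct, h, h]
  clear h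
  revert α β
  decide

lemma card_support_innerLogical : (Finset.univ.filter fun i => innerLogical i ≠ 0).card = 2 := by
  decide

lemma isLeast_logicalWeights_innerCode : IsLeast (logicalWeights innerCode) 2 := by
  rw [innerCode_eq]
  refine isLeast_logicalWeights innerS_le_innerN (v := innerLogical)
    (y := innerShift 1) ?_ ?_ (fun s hs => innerLogical_perp hs) ?_ ?_ card_support_innerLogical
  · intro u hu huS
    refine two_le_card_support_of_mem_innerN hu ?_
    rintro rfl
    exact huS innerS.zero_mem
  · rintro v hv ⟨y, -, hy⟩
    exact two_le_card_support_of_perp_innerS (fun h => hy (by rw [h, zero_dotProduct])) hv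
  · exact mem_innerN.2 ⟨1, by rw [sub_self]; exact innerS.zero_mem⟩
  · rw [innerLogical_dotProduct]
    simp only [innerShift]
    decide

lemma sum_mem_innerS {s : Pt → ZMod 3} (hs : s ∈ innerS) : ∑ p, s p = 0 := by
  obtain ⟨α, β, h⟩ := mem_innerS.1 hs
  simp only [h]
  clear h
  revert α β
  decide

/-- The label `k` is stored as the constant `-k`, so raising it by one subtracts 1 from every
qutrit. -/
lemma implements_inner_x : Implements innerEncoder (tensorGate fun _ => xGateᴴ) xGate := by
  classical
  have h : (tensorGate fun _ : Pt => xGateᴴ) = pauli 0 (fun _ => -1) 0 := by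
    rw [← xOp_eq_pauli]
    ext x y
    have : x = y + (fun _ => -1) ↔ ∀ p, y p = x p + 1 := by
      rw [funext_iff]
      refine forall_congr' fun p => ?_
      rw [Pi.add_apply, ← sub_eq_add_neg, eq_sub_iff_add_eq, eq_comm]
    simp only [tensorGate, xGate, xOp, Matrix.of_apply, Matrix.conjTranspose_apply, this,
      apply_ite star, star_one, star_zero, Finset.prod_ite_zero, Finset.mem_univ, true_imp_iff,
      Finset.prod_const_one]
  rw [Implements, h]
  ext x k
  rw [pauli_mul_apply, Matrix.mul_apply]
  simp only [xGate, Matrix.of_apply, mul_ite, mul_one, mul_zero]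
  rw [Finset.sum_ite_eq' Finset.univ, if_pos (Finset.mem_univ _), innerEncoder, cssEncoder_apply,
    cssEncoder_apply, zero_dotProduct, add_zero, chi_zero, one_mul]
  have : (x - fun _ => -1) - (fun _ => -k) = x - fun _ : Pt => -(k + 1) := by
    ext p
    simp only [Pi.sub_apply]
    ring
  rw [this]

lemma implements_inner_z : Implements innerEncoder (tensorGate fun _ => zGate) zGate := by
  rw [Implements]
  simp only [zGate]
  rw [tensorGate_diagonal]
  refine diagonal_mul_cssEncoder fun k s hs => ?_
  have h : ∀ x : Pt → ZMod 3, ∏ i, chi (x i) = chi (∑ i, x i) := fun x => by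
    simp only [chi_eq_stdAddChar]
    exact (map_prod (ZMod.stdAddChar (N := 3)).toMonoidHom
      (fun i => Multiplicative.ofAdd (x i)) Finset.univ).symm
  rw [h]
  simp only [Pi.add_apply, Finset.sum_add_distrib, sum_mem_innerS hs]
  -- The linear part sums to 0, and eight copies of `-k` sum to `-8k = k` modulo 3.
  congr 1
  clear hs h
  revert k
  decide

/-- Over the whole plane a non-constant affine function takes each value three times and a constant
one takes its value nine times, so the cubes sum to 0 modulo 9. Deleting the origin, where the value
is `-k`, leaves `-(-k)^3 = k^3`. -/
lemma sum_tExp_inner {s : Pt → ZMod 3} (hs : s ∈ innerS) (k : ZMod 3) :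
    ∑ p, tExp (-k + s p) = tExp k := by
  obtain ⟨α, β, h⟩ := mem_innerS.1 hs
  simp only [h]
  clear h hs
  revert α β k
  decide

lemma tensorGate_tGate (ι : Type) [Fintype ι] [DecidableEq ι] :
    (tensorGate fun _ : ι => tGate) =
      Matrix.diagonal fun x => ZMod.stdAddChar (∑ i, tExp (x i)) := by
  simpa [tLayer] using tLayer_eq_diagonal (Finset.univ : Finset ι)

lemma implements_inner_t : Implements innerEncoder (tensorGate fun _ => tGate) tGate := by
  rw [Implements, tensorGate_tGate, tGate_eq_diagonal]
  refine diagonal_mul_cssEncoder fun k s hs => ?_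
  exact congrArg _ (sum_tExp_inner hs k)

/-! ### Concatenation with the inner code -/

section Concatenation

variable {ι κ : Type} [Fintype ι] [DecidableEq ι] [Fintype κ] [DecidableEq κ]

lemma blockEncoder_isometry {V : Matrix (κ → ZMod 3) (ZMod 3) ℂ} (hV : Vᴴ * V = 1) :
    (blockEncoder (ι := ι) V)ᴴ * blockEncoder (ι := ι) V = 1 := by
  ext y z
  have h : ∀ a b, ∑ x, star (V x a) * V x b = if a = b then 1 else 0 := fun a b => by
    simpa [Matrix.mul_apply, Matrix.one_apply] using congrFun (congrFun hV a) b
  have h1 : ∏ i : ι, ∑ x, star (V x (y i)) * V x (z i) = (1 : Matrix (ι → ZMod 3) _ ℂ) y z := by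
    simp only [h, Finset.prod_ite_zero, Finset.prod_const_one, Finset.mem_univ, true_imp_iff,
      Matrix.one_apply, funext_iff]
  rw [← h1, Fintype.prod_sum, Matrix.mul_apply]
  refine Fintype.sum_equiv (Equiv.curry ι κ (ZMod 3)) _ _ fun x => ?_
  rw [Matrix.conjTranspose_apply, blockEncoder, Matrix.of_apply, Matrix.of_apply, star_prod,
    ← Finset.prod_mul_distrib]
  rfl

lemma IsEncoder.concatenate {A : Type} [Fintype A] [DecidableEq A] {E : Matrix (ι → ZMod 3) A ℂ}
    {C : Submodule ℂ ((ι → ZMod 3) → ℂ)} (h : IsEncoder E C)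
    {V : Matrix (κ → ZMod 3) (ZMod 3) ℂ} (hV : Vᴴ * V = 1) :
    IsEncoder (blockEncoder (ι := ι) V * E) (QutritCode.concatenate C V) := by
  refine ⟨?_, ?_⟩
  · rw [Matrix.conjTranspose_mul, Matrix.mul_assoc, ← Matrix.mul_assoc _ (blockEncoder V),
      blockEncoder_isometry hV, Matrix.one_mul, h.1]
  · rw [Matrix.mulVecLin_mul, LinearMap.range_comp, h.2]
    rfl

lemma diagonal_mul_blockEncoder {V : Matrix (κ → ZMod 3) (ZMod 3) ℂ} {d : ι → (κ → ZMod 3) → ℂ}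
    {e : ι → ZMod 3 → ℂ}
    (h : ∀ i, Matrix.diagonal (d i) * V = V * Matrix.diagonal (e i)) :
    Matrix.diagonal (fun x : ι × κ → ZMod 3 => ∏ i, d i fun j => x (i, j)) * blockEncoder (ι := ι) V =
      blockEncoder (ι := ι) V * Matrix.diagonal (fun y : ι → ZMod 3 => ∏ i, e i (y i)) := by
  ext x y
  rw [Matrix.diagonal_mul, Matrix.mul_diagonal, blockEncoder, Matrix.of_apply,
    ← Finset.prod_mul_distrib, ← Finset.prod_mul_distrib]
  refine Finset.prod_congr rfl fun i _ => ?_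
  have := congrFun (congrFun (h i) fun j => x (i, j)) (y i)
  rwa [Matrix.diagonal_mul, Matrix.mul_diagonal] at this

lemma card_support_prod (x : ι × κ → ZMod 3) : (Finset.univ.filter fun q => x q ≠ 0).card =
    ∑ i, (Finset.univ.filter fun j => x (i, j) ≠ 0).card := by
  simp only [Finset.card_filter]
  exact Fintype.sum_prod_type _

lemma four_le_card_support {x : ι × κ → ZMod 3}
    (h : ∀ i, (fun j => x (i, j)) ≠ 0 → 2 ≤ (Finset.univ.filter fun j => x (i, j) ≠ 0).card)
    {T : Finset ι} (hT : 2 ≤ T.card) (hx : ∀ i ∈ T, (fun j => x (i, j)) ≠ 0) :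
    4 ≤ (Finset.univ.filter fun q => x q ≠ 0).card := by
  rw [card_support_prod]
  calc 4 ≤ T.card • 2 := by rw [smul_eq_mul]; omega
    _ ≤ ∑ i ∈ T, (Finset.univ.filter fun j => x (i, j) ≠ 0).card :=
        Finset.card_nsmul_le_sum _ _ _ fun i hi => h i (hx i hi)
    _ ≤ _ := Finset.sum_le_univ_sum_of_nonneg fun _ => Nat.zero_le _

/-- The block vectors whose blocks are, modulo linear functions, the constants encoding a vector
of `M`. -/
def innerEncode (M : Submodule (ZMod 3) (ι → ZMod 3)) : Submodule (ZMod 3) (ι × Pt → ZMod 3) where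
  carrier := {x | ∃ y ∈ M, ∀ i, (fun j => x (i, j)) - innerShift (y i) ∈ innerS}
  zero_mem' := ⟨0, M.zero_mem, fun i => by
    convert innerS.zero_mem using 1
    ext j; simp [innerShift]⟩
  add_mem' := by
    rintro x x' ⟨y, hy, h⟩ ⟨y', hy', h'⟩
    refine ⟨y + y', M.add_mem hy hy', fun i => ?_⟩
    convert innerS.add_mem (h i) (h' i) using 1
    ext j
    simp only [innerShift, Pi.add_apply, Pi.sub_apply]
    ring
  smul_mem' := by
    rintro c x ⟨y, hy, h⟩
    refine ⟨c • y, M.smul_mem c hy, fun i => ?_⟩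
    convert innerS.smul_mem c (h i) using 1
    ext j
    simp only [innerShift, Pi.smul_apply, Pi.sub_apply, smul_eq_mul]
    ring

lemma innerEncode_mono {M M' : Submodule (ZMod 3) (ι → ZMod 3)} (h : M ≤ M') :
    innerEncode M ≤ innerEncode M' := fun _ ⟨y, hy, hx⟩ => ⟨y, h hy, hx⟩

lemma innerShift_mem_innerEncode {M : Submodule (ZMod 3) (ι → ZMod 3)} {y : ι → ZMod 3}
    (hy : y ∈ M) : (fun q : ι × Pt => -y q.1) ∈ innerEncode M :=
  ⟨y, hy, fun i => by
    convert innerS.zero_mem using 1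
    exact sub_self _⟩

/-- Each column is a multiple of the indicator of a product of cosets; of the common factor only its
being non-zero matters. -/
lemma exists_blockEncoder_innerEncoder_apply : ∃ c : ℂ, c ≠ 0 ∧
    ∀ (x : ι × Pt → ZMod 3) (y : ι → ZMod 3)
      [Decidable (∀ i, (fun j => x (i, j)) - innerShift (y i) ∈ innerS)],
      blockEncoder innerEncoder x y =
        if ∀ i, (fun j => x (i, j)) - innerShift (y i) ∈ innerS then c else 0 := by
  classical
  refine ⟨((Real.sqrt (Nat.card innerS) : ℂ)⁻¹) ^ Fintype.card ι,
    pow_ne_zero _ (inv_ne_zero (sqrt_natCard_ne_zero _)), fun x y _ => ?_⟩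
  have h : ∀ (z : Pt → ZMod 3) (k : ZMod 3), innerEncoder z k =
      if z - innerShift k ∈ innerS then ((Real.sqrt (Nat.card innerS))⁻¹ : ℂ) else 0 :=
    fun z k => cssEncoder_apply _ _ _ _
  simp only [blockEncoder, Matrix.of_apply, h]
  rw [Finset.prod_ite_zero]
  simp only [Finset.mem_univ, true_imp_iff, Finset.prod_const, Finset.card_univ]

/-- Distinct words `y` are encoded on disjoint sets of block vectors, so an encoded state is, up to
a constant, the function `ψ` read off through the label `y`. Support and translation invariance
therefore carry over in both directions. -/
lemma concatenate_innerEncoder (S N : Submodule (ZMod 3) (ι → ZMod 3)) :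
    concatenate (cssSpace S N) innerEncoder = cssSpace (innerEncode S) (innerEncode N) := by
  classical
  obtain ⟨c, hc, hB⟩ := exists_blockEncoder_innerEncoder_apply (ι := ι)
  have hB' : ∀ ψ x, (blockEncoder (ι := ι) innerEncoder *ᵥ ψ) x = ∑ y, (if ∀ i, (fun j => x (i, j)) -
      innerShift (y i) ∈ innerS then c else 0) * ψ y := fun ψ x => by
    rw [Matrix.mulVec, dotProduct]
    exact Finset.sum_congr rfl fun y _ => by rw [hB]
  ext φ
  constructor
  · rintro ⟨ψ, ⟨hN, hS⟩, rfl⟩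
    rw [Matrix.mulVecLin_apply]
    refine ⟨fun x hx => ?_, fun s hs x => ?_⟩
    · rw [hB'] at hx
      obtain ⟨y, -, hy⟩ := Finset.exists_ne_zero_of_sum_ne_zero hx
      exact ⟨y, hN y (right_ne_zero_of_mul hy), of_not_not fun h => hy (by rw [if_neg h, zero_mul])⟩
    · obtain ⟨t, ht, hst⟩ := hs
      rw [hB', hB']
      symm
      refine Fintype.sum_equiv (Equiv.addRight t) _ _ fun y => ?_
      rw [Equiv.coe_addRight, hS t ht]
      congr 2
      refine propext (forall_congr' fun i => ?_)
      rw [← innerS.add_mem_iff_left (hst i)]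
      have : (fun j => (x + s) (i, j)) - innerShift ((y + t) i) =
          (fun j => x (i, j)) - innerShift (y i) + ((fun j => s (i, j)) - innerShift (t i)) := by
        ext j
        simp only [innerShift, Pi.add_apply, Pi.sub_apply]
        ring
      rw [this]
  · rintro ⟨hN, hS⟩
    -- The preimage reads `φ` at the blockwise constant representative of `y`.
    refine ⟨fun y => c⁻¹ * φ fun q => -y q.1, ⟨fun y hy => ?_, fun s hs y => ?_⟩, ?_⟩
    · obtain ⟨z, hz, h⟩ := hN _ (right_ne_zero_of_mul hy)
      convert hz
      ext i
      have := innerShift_sub (y i) (z i) ▸ h i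
      exact sub_eq_zero.1 (innerShift_mem_innerS this)
    · refine congrArg (c⁻¹ * ·) ?_
      refine (congrArg φ (funext fun q => ?_)).trans (hS _ (innerShift_mem_innerEncode hs) _)
      exact neg_add _ _
    · ext x
      rw [Matrix.mulVecLin_apply, hB']
      by_cases hx : ∃ y : ι → ZMod 3, ∀ i, (fun j => x (i, j)) - innerShift (y i) ∈ innerS
      · obtain ⟨y, hy⟩ := hx
        rw [Finset.sum_eq_single_of_mem y (Finset.mem_univ y), if_pos hy,
          mul_inv_cancel_left₀ hc]
        -- `x` differs from its representative by linear functions in every block, an element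
        -- encoding the zero word of `S`.
        · rw [← hS (fun q => x q + y q.1) ⟨0, S.zero_mem, fun i => ?_⟩]
          · congr 1
            ext q
            simp
          · convert hy i using 1
            ext j
            simp [innerShift]
        · intro z _ hzy
          rw [if_neg, zero_mul]
          intro hz
          refine hzy (funext fun i => ?_)
          have := innerS.sub_mem (hy i) (hz i)
          rw [sub_sub_sub_cancel_left, innerShift_sub] at this
          exact sub_eq_zero.1 (innerShift_mem_innerS this)
      · rw [Finset.sum_eq_zero fun y _ => by rw [if_neg fun h => hx ⟨y, h⟩, zero_mul]]
        by_contra h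
        obtain ⟨y, -, hy⟩ := hN x (Ne.symm h)
        exact hx ⟨y, hy⟩

end Concatenation

/-! ### The concatenated code -/

lemma concatCode_eq : concatCode = cssSpace (innerEncode outerS) (innerEncode outerN) := by
  rw [concatCode, outerCode_eq, concatenate_innerEncoder]

lemma cstarMatrix_mul_eq {l m n : Type} [Fintype m] (M : Matrix l m ℂ) (N : Matrix m n ℂ) :
    (@HMul.hMul (CStarMatrix l m ℂ) (CStarMatrix m n ℂ) (CStarMatrix l n ℂ) _ M N) = M * N := rfl

lemma concatEncoder_eq :
    concatEncoder = blockEncoder (ι := Fin 6) innerEncoder * outerEncoder :=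
  cstarMatrix_mul_eq _ _

lemma isEncoder_concatEncoder : IsEncoder concatEncoder concatCode := by
  rw [concatEncoder_eq]
  exact isEncoder_outerEncoder.concatenate isEncoder_innerEncoder.1

/-- A Z-type operator of weight four acting non-trivially on the concatenated code. -/
def concatLogical : Fin 6 × Pt → ZMod 3 :=
  fun q => (![1, 2, 0, 0, 0, 0] : Fin 6 → ZMod 3) q.1 * innerLogical q.2

/-- In each block `innerLogical` ignores linear functions and sends the constant `-y i` to `-2 (y i)
= y i`, so the pairing takes place between outer words. -/
lemma concatLogical_dotProduct {x : Fin 6 × Pt → ZMod 3} {y : Fin 6 → ZMod 3}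
    (h : ∀ i, (fun j => x (i, j)) - innerShift (y i) ∈ innerS) :
    concatLogical ⬝ᵥ x = ![1, 2, 0, 0, 0, 0] ⬝ᵥ y := by
  rw [dotProduct, Fintype.sum_prod_type, dotProduct]
  refine Finset.sum_congr rfl fun i _ => ?_
  have := innerLogical_perp (h i)
  rw [dotProduct_sub, innerLogical_dotProduct (innerShift _), sub_eq_zero] at this
  simp only [concatLogical, mul_assoc]
  rw [← Finset.mul_sum]
  congr 1
  refine this.trans ?_
  simp only [innerShift]
  grind

lemma isLeast_logicalWeights_concatCode : IsLeast (logicalWeights concatCode) 4 := by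
  rw [concatCode_eq]
  refine isLeast_logicalWeights (innerEncode_mono outerS_le_outerN) (v := concatLogical)
    (y := fun q => -outerShift ![1, 0] q.1) ?_ ?_ ?_
    (innerShift_mem_innerEncode (outerShift_mem _)) ?_ ?_
  -- X-type operators: the encoded outer word is non-zero, hence has two non-zero entries, and each
  -- makes its block a non-zero affine function.
  · rintro u ⟨y, hy, h⟩ huS
    have h0 : y ≠ 0 := by
      rintro rfl
      exact huS ⟨0, outerS.zero_mem, h⟩
    refine four_le_card_support (fun i hi => two_le_card_support_of_mem_innerN
      (mem_innerN.2 ⟨y i, h i⟩) hi) (two_le_card_support_of_mem_outerN hy h0) fun i hi hu => ?_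
    have := h i
    rw [hu, zero_sub, innerS.neg_mem_iff] at this
    exact (Finset.mem_filter.1 hi).2 (innerShift_mem_innerS this)
  -- Z-type operators: every block of `v` is orthogonal to the linear functions, so a non-zero block
  -- has weight at least two. If only block `k` were non-zero, orthogonality to the outer all-ones
  -- stabilizer would make it orthogonal to constants as well, and `v` would act trivially.
  · rintro v hv ⟨x, ⟨y, hy, h⟩, hx⟩
    have hdot : ∀ z : Fin 6 × Pt → ZMod 3,
        v ⬝ᵥ z = ∑ i, (fun j => v (i, j)) ⬝ᵥ (fun j => z (i, j)) := fun z =>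
      Fintype.sum_prod_type _
    have hblock : ∀ i, ∀ s ∈ innerS, (fun j => v (i, j)) ⬝ᵥ s = 0 := by
      intro i s hs
      have := hv (fun q => if q.1 = i then s q.2 else 0) ⟨0, outerS.zero_mem, fun k => ?_⟩
      · rw [hdot, Finset.sum_eq_single_of_mem i (Finset.mem_univ i)] at this
        · simpa using this
        · intro k _ hk
          simp [hk, dotProduct]
      · by_cases hk : k = i
        · convert hs using 1
          ext j
          simp [hk, innerShift]
        · convert innerS.zero_mem using 1
          ext j
          simp [hk, innerShift]
    refine four_le_card_support (T := Finset.univ.filter fun i => (fun j => v (i, j)) ≠ 0)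
      (fun i hi => two_le_card_support_of_perp_innerS hi (hblock i)) ?_
      fun i hi => (Finset.mem_filter.1 hi).2
    by_contra! hlt
    obtain ⟨k, hk⟩ : ∃ k, ∀ i, i ≠ k → (fun j => v (i, j)) = 0 := by
      rcases (Finset.univ.filter fun i => (fun j => v (i, j)) ≠ 0).eq_empty_or_nonempty with h | h
      · exact ⟨0, fun i _ => by simpa using Finset.filter_eq_empty_iff.1 h (Finset.mem_univ i)⟩
      · obtain ⟨k, hk⟩ := h
        refine ⟨k, fun i hi => ?_⟩
        by_contra h
        exact hi (Finset.card_le_one.1 (Nat.lt_succ_iff.1 hlt) i (by simpa using h) k hk)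
    have hdot' : ∀ z : Fin 6 × Pt → ZMod 3,
        v ⬝ᵥ z = (fun j => v (k, j)) ⬝ᵥ (fun j => z (k, j)) := fun z => by
      rw [hdot]
      refine Finset.sum_eq_single_of_mem k (Finset.mem_univ k) fun i _ hi => ?_
      rw [hk i hi, zero_dotProduct]
    -- The outer word `-1` is encoded by the constant 1 on all blocks.
    have h1 := hv _ (innerShift_mem_innerEncode (mem_outerS.2 ⟨-1, fun i => rfl⟩))
    have h2 := hblock k _ (h k)
    have h3 : innerShift (y k) = (-y k) • fun _ : Pt => (1 : ZMod 3) := by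
      ext j; simp [innerShift]
    rw [hdot', neg_neg] at h1
    rw [dotProduct_sub, h3, dotProduct_smul, h1, smul_zero, sub_zero] at h2
    exact hx ((hdot' x).trans h2)
  · rintro s ⟨y, hy, h⟩
    obtain ⟨c, hc⟩ := mem_outerS.1 hy
    rw [concatLogical_dotProduct h, funext hc]
    clear hc
    revert c
    decide
  · rw [concatLogical_dotProduct (y := outerShift ![1, 0])]
    · decide
    · intro i
      convert innerS.zero_mem using 1
      exact sub_self _
  · decide

/-! ### The transversal gate of the concatenated code -/

lemma diagonal_neg_tExp_mul_innerEncoder :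
    Matrix.diagonal (fun x : Pt → ZMod 3 => (ZMod.stdAddChar (∑ p, -tExp (x p)) : ℂ)) *
      innerEncoder = innerEncoder * Matrix.diagonal fun k => ZMod.stdAddChar (-tExp k) := by
  refine diagonal_mul_cssEncoder fun k s hs => ?_
  rw [Finset.sum_neg_distrib]
  exact congrArg (fun t => (ZMod.stdAddChar (-t) : ℂ)) (sum_tExp_inner hs k)

lemma diagonal_tExp_mul_innerEncoder :
    Matrix.diagonal (fun x : Pt → ZMod 3 => (ZMod.stdAddChar (∑ p, tExp (x p)) : ℂ)) *
      innerEncoder = innerEncoder * Matrix.diagonal fun k => ZMod.stdAddChar (tExp k) :=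
  diagonal_mul_cssEncoder fun k _ hs => congrArg _ (sum_tExp_inner hs k)

/-- Eight `T` gates on a block are one logical `T`, and eight `T†` one logical `T†`, so the physical
layer descends to the layer on the outer code. -/
lemma tLayer_mul_blockEncoder : tLayer firstBlocks * blockEncoder (ι := Fin 6) innerEncoder =
    blockEncoder (ι := Fin 6) innerEncoder * tLayer ({0, 1, 2} : Finset (Fin 6)) := by
  have hmem : ∀ q : Fin 6 × Pt, q ∈ firstBlocks ↔ q.1 ∈ ({0, 1, 2} : Finset (Fin 6)) := by
    rintro ⟨i, p⟩
    simp only [firstBlocks, Finset.mem_filter, Finset.mem_univ, true_and]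
    revert i
    decide
  rw [tLayer_eq_diagonal, tLayer_eq_diagonal]
  simp only [hmem, Fintype.sum_prod_type, ← stdAddChar_sum (ι := Fin 6)]
  refine diagonal_mul_blockEncoder (ι := Fin 6) (κ := Pt)
    (d := fun i x => ZMod.stdAddChar (∑ p, if i ∈ ({0, 1, 2} : Finset (Fin 6)) then tExp (x p)
      else -tExp (x p)))
    (e := fun i k => ZMod.stdAddChar (if i ∈ ({0, 1, 2} : Finset (Fin 6)) then tExp k
      else -tExp k)) fun i => ?_
  split_ifs
  · exact diagonal_tExp_mul_innerEncoder
  · exact diagonal_neg_tExp_mul_innerEncoder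

lemma implements_concat_and : Implements concatEncoder (tLayer firstBlocks) andGate := by
  rw [Implements, concatEncoder_eq, ← Matrix.mul_assoc, tLayer_mul_blockEncoder, Matrix.mul_assoc,
    implements_outer_and, Matrix.mul_assoc]

/-! ### The parameters of the three codes -/

lemma isQutritCode_outerCode : IsQutritCode 6 2 2 outerCode where
  stabilizer := ⟨_, rfl⟩
  length := rfl
  dimension := by rw [isEncoder_outerEncoder.finrank]; rfl
  distance := isLeast_logicalWeights_outerCode

lemma isQutritCode_innerCode : IsQutritCode 8 1 2 innerCode where
  stabilizer := ⟨_, rfl⟩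
  length := by decide
  dimension := by rw [isEncoder_innerEncoder.finrank]; rfl
  distance := isLeast_logicalWeights_innerCode

lemma isQutritCode_concatCode : IsQutritCode 48 2 4 concatCode where
  stabilizer := by
    rw [concatCode_eq]
    exact exists_cssSpace_eq_fixedSpace _ _
  length := by decide
  dimension := by rw [isEncoder_concatEncoder.finrank]; rfl
  distance := isLeast_logicalWeights_concatCode

end QutritCode

end

theorem mainTheorem2 :
    -- the logical gate is a unitary that emulates binary AND
    (andGateᴴ * andGate = 1 ∧ EmulatesAnd andGate) ∧
    -- the outer code, with its logical Pauli operators and transversal AND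
    (IsQutritCode 6 2 2 outerCode ∧ IsEncoder outerEncoder outerCode ∧
      Implements outerEncoder (pauli 0 ![2, 1, 0, 2, 1, 0] 0) (xOp ![1, 0]) ∧
      Implements outerEncoder (pauli 2 ![1, 1, 1, 0, 0, 0] ![0, 0, 0, 1, 2, 0]) (zOp ![1, 0]) ∧
      Implements outerEncoder (pauli 0 ![1, 2, 0, 1, 2, 0] ![0, 0, 2, 0, 0, 1]) (xOp ![0, 1]) ∧
      Implements outerEncoder (pauli 0 ![1, 1, 1, 0, 0, 0] 0) (zOp ![0, 1]) ∧
      Implements outerEncoder (tLayer {0, 1, 2}) andGate) ∧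
    -- the inner code, with its logical Pauli operators and transversal T
    (IsQutritCode 8 1 2 innerCode ∧ IsEncoder innerEncoder innerCode ∧
      Implements innerEncoder (tensorGate fun _ => xGateᴴ) xGate ∧
      Implements innerEncoder (tensorGate fun _ => zGate) zGate ∧
      Implements innerEncoder (tensorGate fun _ => tGate) tGate) ∧
    -- the concatenated code, with transversal AND by 24 T and 24 T† gates
    (IsQutritCode 48 2 4 concatCode ∧
      codeDistance concatCode = codeDistance outerCode * codeDistance innerCode ∧
      IsEncoder concatEncoder concatCode ∧
      Implements concatEncoder (tLayer firstBlocks) andGate ∧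
      firstBlocks.card = 24 ∧ firstBlocksᶜ.card = 24) := by
  have hcard : firstBlocks.card = 24 := by decide
  refine ⟨⟨andGate_unitary, emulatesAnd_andGate⟩,
    ⟨isQutritCode_outerCode, isEncoder_outerEncoder, implements_outer_x1, implements_outer_z1,
      implements_outer_x2, implements_outer_z2, implements_outer_and⟩,
    ⟨isQutritCode_innerCode, isEncoder_innerEncoder, implements_inner_x, implements_inner_z,
      implements_inner_t⟩,
    ⟨isQutritCode_concatCode, ?_, isEncoder_concatEncoder, implements_concat_and, hcard, ?_⟩⟩
  · rw [codeDistance, codeDistance, codeDistance, isLeast_logicalWeights_concatCode.csInf_eq,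
      isLeast_logicalWeights_outerCode.csInf_eq, isLeast_logicalWeights_innerCode.csInf_eq]
  · rw [Finset.card_compl, hcard, isQutritCode_concatCode.length]
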